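/- **Setting.** Let $\mathcal V\subseteq\mathbf{Cat}$ be a full sub-2-category of the 2-category of small categories, closed in $\mathbf{Cat}$ under small limits and exponentials, having small colimits, and containing the arrow category $\mathbf 2$ (for example $\mathbf{Cat}$, preorders, or posets). For a $\mathcal V$-category $\mathcal C$, $\mathcal C^{\mathbf 2}$ is the $\mathcal V$-category of arrows of $\mathcal C$, with $\mathcal C^{\mathbf 2}(f,g)$ the pullback of $\mathcal C(\mathrm{dom} f,\mathrm{dom} g)\to\mathcal C(\mathrm{dom} f,\mathrm{cod} g)\leftarrow\mathcal C(\mathrm{cod} f,\mathrm{cod} g)$. A *$\mathcal V$-enriched AWFS* $(\mathsf E,\mathsf M)$ on $\mathcal C$ consists of a $\mathcal V$-functor $K:\mathcal C^{\mathbf 2}\to\mathcal C$ and $\mathcal V$-natural $\lambda:\mathrm{dom}\Rightarrow K$, $\rho:K\Rightarrow\mathrm{cod}$ with $\rho_f\lambda_f=f$; a comonad structure $\mathsf E$ on the endo-$\mathcal V$-functor $f\mapsto\lambda_f$ of $\mathcal C^{\mathbf 2}$, with counit $(1,\rho_f)$ and comultiplication $(1,\sigma_f)$; and a monad structure $\mathsf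 M$ on $f\mapsto\rho_f$, with unit $(\lambda_f,1)$ and multiplication $(\pi_f,1)$; such that $(\sigma_f,\pi_f):\lambda_{\rho_f}\to\rho_{\lambda_f}$ is a mixed distributive law. It is *cocontinuous* if $K$ preserves small colimits. An $\mathsf M$-algebra is an arrow $g$ with a structure map $p:Kg\to\mathrm{dom}\,g$ such that $(p,1):\rho_g\to g$ satisfies the algebra axioms; for any AWFS such algebras compose canonically: for algebras $(f,p)$, $(g,q)$ with $\mathrm{cod} f=\mathrm{dom} g$, the structure on $gf$ is $p\cdot K(1,\,q\cdot K(f,1))\cdot\sigma_{gf}$. They can also be pulled back, uniquely so that the pullback square is an algebra morphism. Let $\mathbb J=(\mathcal J\rightrightarrows\mathcal J_0)$ be a small category internal to the category of small $\mathcal V$-categories, and $U:\mathbb J\to\mathbb{S}\mathrm{q}(\mathcal C)$ an internal functor to the internal category of squares $\mathcal C^{\mathbf 2}\rightrightarrows\mathcal C$. Let $(\mathsf E,\mathsf M)$ be a $\mathcal V$-enriched AWFS on $\mathcal V$. For $f:X\to Y$ in $\mathcal C$ and $i\in\mathcal J$ put $$W_i(f)=\mathcal C^{\mathbf 2}(Ui,(1,f)):\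 \mathcal C(\mathrm{cod}\,Ui,X)\cong\mathcal C^{\mathbf 2}(Ui,1_X)\longrightarrow\mathcal C^{\mathbf 2}(Ui,f),\qquad k\mapsto(k\cdot Ui,\ f\cdot k).$$ An object of the $\mathcal V$-category $\mathbb J^{\pitchfork\!\!\!\pitchfork_{\mathsf M}}$ is an arrow $f$ of $\mathcal C$ with an $\mathsf M$-algebra structure $p_i$ on each $W_i(f)$, $\mathcal V$-natural in $i$, such that for all vertically composable $i$ and $j$ the structure at $j\bullet i$ is that of the composite algebra $$\mathcal C(\mathrm{cod}\,Uj,X)\xrightarrow{\,W_j(f)\,}\mathcal C^{\mathbf 2}(Uj,f)\longrightarrow\mathcal C^{\mathbf 2}(Uj\cdot Ui,f),$$ where the second arrow $(h,k)\mapsto(h\cdot Ui,k)$ is the pullback of $W_i(f)$ along $\mathcal C^{\mathbf 2}(Uj\cdot Ui,f)\to\mathcal C^{\mathbf 2}(Ui,f)$, $(h,k)\mapsto(h,k\cdot Uj)$, and carries the pulled-back algebra structure. The hom-object from $(f,p)$ to $(g,q)$ is the equaliser in $\mathcal V$ of $\mathcal C^{\mathbf 2}(f,g)\rightrightarrows\prod_i[K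 W_i(f),\mathcal C(\mathrm{cod}\,Ui,\mathrm{dom}\,g)]$ that expresses compatibility with the algebra structures. There is an evident forgetful functor $\mathbb J^{\pitchfork\!\!\!\pitchfork_{\mathsf M}}\to\mathcal C^{\mathbf 2}$. An orthogonal factorisation system $(\mathcal E,\mathcal M)$ is *proper* if $\mathcal E$ consists of epimorphisms and $\mathcal M$ of monomorphisms. A category $\mathcal A$ is *locally ranked* with respect to a proper $(\mathcal E,\mathcal M)$ if it is cocomplete; for each object $X$ there is, up to isomorphism, only a small set of morphisms in $\mathcal E$ with domain $X$; and each object $A$ has a *rank*, i.e. there is a regular cardinal $\kappa$ such that $\mathcal A(A,-)$ preserves the colimit of every small $\kappa$-filtered diagram $(X_d)$ that admits a cocone $(X_d\to X)$ with components in $\mathcal M$. **Proposition.** Suppose that $\mathcal V$ is equipped with a cocontinuous $\mathcal V$-enriched AWFS $(\mathsf E,\mathsf M)$, that $\mathcal C$ is a cocomplete $\mathcal V$-category (it has small conical colimits and tensors with objects of $\mathcal V$), and that the underlying category of $\mathcal C$ is locally ranked with respect to a proper orthogonal factorisation system $(\mathcal E,\mathcal M)$. Let $\mathbb J$ be a small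 internal category in $\mathcal V$-categories over $\mathbb{S}\mathrm{q}(\mathcal C)$. Then there is a regular cardinal $\kappa$ such that the forgetful functor $\mathbb J^{\pitchfork\!\!\!\pitchfork_{\mathsf M}}\to\mathcal C^{\mathbf 2}$ creates $\kappa$-filtered colimits of $\mathcal M$-subobjects: for every small $\kappa$-filtered $\mathcal D$ and every diagram $D:\mathcal D\to\mathbb J^{\pitchfork\!\!\!\pitchfork_{\mathsf M}}$ whose image in $\mathcal C^{\mathbf 2}$ admits a cocone with components componentwise in $\mathcal M$, each colimit cocone of that image in $\mathcal C^{\mathbf 2}$ lifts to exactly one cocone under $D$, and the lifted cocone is a ($\mathcal V$-enriched) colimit of $D$. -/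

import Mathlib

open CategoryTheory Limits
open MonoidalCategory hiding tensorHom_def

namespace EnrichedAWFS

universe v₁ u₁ v₂ u₂ v₃ u₃ w

/-! ### The arrow `V`-category `C^2` -/

section Arrow

variable (V : Type u₁) [Category.{v₁} V] [MonoidalCategory V]
variable {C : Type u₂} [Category.{v₂} C] [EnrichedOrdinaryCategory V C]

lemma eComp_dinatural {A B : V} (W : C) {X Y : C} (Z : C) (g : X ⟶ Y)
    (a : A ⟶ (W ⟶[V] X)) (b : B ⟶ (Y ⟶[V] Z)) :
    (a ⊗ₘ (b ≫ eHomWhiskerRight V g Z)) ≫ eComp V W X Z =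
      ((a ≫ eHomWhiskerLeft V W g) ⊗ₘ b) ≫ eComp V W Y Z := by
  have key : (W ⟶[V] X) ◁ eHomWhiskerRight V g Z ≫ eComp V W X Z =
      eHomWhiskerLeft V W g ▷ (Y ⟶[V] Z) ≫ eComp V W Y Z := by
    simp only [eHomWhiskerRight, eHomWhiskerLeft, MonoidalCategory.whiskerLeft_comp,
      comp_whiskerRight, Category.assoc]
    rw [← e_assoc]
    simp
  have h1 : a ⊗ₘ (b ≫ eHomWhiskerRight V g Z) =
      (a ⊗ₘ b) ≫ (_ ◁ eHomWhiskerRight V g Z) := by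
    rw [← id_tensorHom, tensorHom_comp_tensorHom, Category.comp_id]
  have h2 : (a ≫ eHomWhiskerLeft V W g) ⊗ₘ b =
      (a ⊗ₘ b) ≫ (eHomWhiskerLeft V W g ▷ _) := by
    rw [← tensorHom_id, tensorHom_comp_tensorHom, Category.comp_id]
  rw [h1, h2, Category.assoc, Category.assoc, key]

lemma eHomEquiv_whiskerLeft {X Y Z : C} (f : X ⟶ Y) (g : Y ⟶ Z) :
    eHomEquiv V f ≫ eHomWhiskerLeft V X g = eHomEquiv V (f ≫ g) := by
  rw [eHomEquiv_comp, eHomWhiskerLeft, rightUnitor_inv_naturality_assoc,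
    MonoidalCategory.tensorHom_def]
  simp [unitors_inv_equal]

lemma eHomEquiv_whiskerRight {X Y Z : C} (f : X ⟶ Y) (g : Y ⟶ Z) :
    eHomEquiv V g ≫ eHomWhiskerRight V f Z = eHomEquiv V (f ≫ g) := by
  rw [eHomEquiv_comp, eHomWhiskerRight, leftUnitor_inv_naturality_assoc, tensorHom_def']
  simp

lemma aux_id_comp {A : V} (X Y : C) (a : A ⟶ (X ⟶[V] Y)) :
    (λ_ A).inv ≫ (eId V X ⊗ₘ a) ≫ eComp V X X Y = a := by
  rw [tensorHom_def', Category.assoc, ← leftUnitor_inv_naturality_assoc, e_id_comp,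
    Category.comp_id]

lemma aux_comp_id {A : V} (X Y : C) (a : A ⟶ (X ⟶[V] Y)) :
    (ρ_ A).inv ≫ (a ⊗ₘ eId V Y) ≫ eComp V X Y Y = a := by
  rw [MonoidalCategory.tensorHom_def, Category.assoc, ← rightUnitor_inv_naturality_assoc,
    e_comp_id, Category.comp_id]

lemma aux_assoc {A B D : V} (W X Y Z : C) (a : A ⟶ (W ⟶[V] X)) (b : B ⟶ (X ⟶[V] Y))
    (d : D ⟶ (Y ⟶[V] Z)) :
    (α_ A B D).inv ≫ (((a ⊗ₘ b) ≫ eComp V W X Y) ⊗ₘ d) ≫ eComp V W Y Z =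
      (a ⊗ₘ ((b ⊗ₘ d) ≫ eComp V X Y Z)) ≫ eComp V W X Z := by
  have h1 : ((a ⊗ₘ b) ≫ eComp V W X Y) ⊗ₘ d = ((a ⊗ₘ b) ⊗ₘ d) ≫ eComp V W X Y ▷ _ := by
    rw [← tensorHom_id, tensorHom_comp_tensorHom, Category.comp_id]
  have h2 : a ⊗ₘ ((b ⊗ₘ d) ≫ eComp V X Y Z) = (a ⊗ₘ (b ⊗ₘ d)) ≫ _ ◁ eComp V X Y Z := by
    rw [← id_tensorHom, tensorHom_comp_tensorHom, Category.comp_id]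
  rw [h1, h2, Category.assoc, Category.assoc, ← e_assoc, associator_inv_naturality_assoc]

variable [HasPullbacks V]

/-- The hom-object `C^2(f, g)`: the pullback of
`C(dom f, dom g) ⟶ C(dom f, cod g) ⟵ C(cod f, cod g)`. -/
noncomputable def arrowHom (f g : Arrow C) : V :=
  pullback (eHomWhiskerLeft V f.left g.hom) (eHomWhiskerRight V f.hom g.right)

/-- The projection `C^2(f, g) ⟶ C(dom f, dom g)`. -/
noncomputable def arrowFst (f g : Arrow C) : arrowHom V f g ⟶ (f.left ⟶[V] g.left) :=
  pullback.fst _ _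

/-- The projection `C^2(f, g) ⟶ C(cod f, cod g)`. -/
noncomputable def arrowSnd (f g : Arrow C) : arrowHom V f g ⟶ (f.right ⟶[V] g.right) :=
  pullback.snd _ _

lemma arrow_condition (f g : Arrow C) :
    arrowFst V f g ≫ eHomWhiskerLeft V f.left g.hom =
      arrowSnd V f g ≫ eHomWhiskerRight V f.hom g.right := pullback.condition

/-- The universal property of `C^2(f, g)`. -/
noncomputable def arrowLift {f g : Arrow C} {X : V} (a : X ⟶ (f.left ⟶[V] g.left))
    (b : X ⟶ (f.right ⟶[V] g.right))
    (h : a ≫ eHomWhiskerLeft V f.left g.hom = b ≫ eHomWhiskerRight V f.hom g.right) :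
    X ⟶ arrowHom V f g := pullback.lift a b h

@[simp]
lemma arrowLift_fst {f g : Arrow C} {X : V} (a : X ⟶ (f.left ⟶[V] g.left))
    (b : X ⟶ (f.right ⟶[V] g.right)) (h) :
    arrowLift V a b h ≫ arrowFst V f g = a := pullback.lift_fst _ _ _

@[simp]
lemma arrowLift_snd {f g : Arrow C} {X : V} (a : X ⟶ (f.left ⟶[V] g.left))
    (b : X ⟶ (f.right ⟶[V] g.right)) (h) :
    arrowLift V a b h ≫ arrowSnd V f g = b := pullback.lift_snd _ _ _

lemma arrowHom_ext {f g : Arrow C} {X : V} {a b : X ⟶ arrowHom V f g}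
    (h₁ : a ≫ arrowFst V f g = b ≫ arrowFst V f g)
    (h₂ : a ≫ arrowSnd V f g = b ≫ arrowSnd V f g) : a = b := pullback.hom_ext h₁ h₂

/-- The identity of `f` in `C^2`. -/
noncomputable def arrowId (f : Arrow C) : 𝟙_ V ⟶ arrowHom V f f :=
  arrowLift V (eId V f.left) (eId V f.right) (by
    rw [← eHomEquiv_id, ← eHomEquiv_id, eHomEquiv_whiskerLeft, eHomEquiv_whiskerRight]; simp)

/-- The composition of `C^2`, computed componentwise. -/
noncomputable def arrowComp (f g h : Arrow C) :
    arrowHom V f g ⊗ arrowHom V g h ⟶ arrowHom V f h :=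
  arrowLift V
    ((arrowFst V f g ⊗ₘ arrowFst V g h) ≫ eComp V _ _ _)
    ((arrowSnd V f g ⊗ₘ arrowSnd V g h) ≫ eComp V _ _ _) (by
      have e1 : (arrowFst V f g ⊗ₘ arrowFst V g h) ≫ _ ◁ eHomWhiskerLeft V g.left h.hom =
          arrowFst V f g ⊗ₘ (arrowSnd V g h ≫ eHomWhiskerRight V g.hom h.right) := by
        rw [← arrow_condition, ← id_tensorHom, tensorHom_comp_tensorHom, Category.comp_id]
      have e2 : (arrowSnd V f g ⊗ₘ arrowSnd V g h) ≫ eHomWhiskerRight V f.hom g.right ▷ _ =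
          (arrowFst V f g ≫ eHomWhiskerLeft V f.left g.hom) ⊗ₘ arrowSnd V g h := by
        rw [arrow_condition, ← tensorHom_id, tensorHom_comp_tensorHom, Category.comp_id]
      rw [Category.assoc, Category.assoc, eComp_eHomWhiskerLeft, eComp_eHomWhiskerRight,
        reassoc_of% e1, reassoc_of% e2, eComp_dinatural])

@[simp]
lemma arrowId_fst (f : Arrow C) : arrowId V f ≫ arrowFst V f f = eId V f.left :=
  arrowLift_fst _ _ _ _

@[simp]
lemma arrowId_snd (f : Arrow C) : arrowId V f ≫ arrowSnd V f f = eId V f.right :=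
  arrowLift_snd _ _ _ _

@[simp]
lemma arrowComp_fst (f g h : Arrow C) : arrowComp V f g h ≫ arrowFst V f h =
    (arrowFst V f g ⊗ₘ arrowFst V g h) ≫ eComp V _ _ _ :=
  arrowLift_fst _ _ _ _

@[simp]
lemma arrowComp_snd (f g h : Arrow C) : arrowComp V f g h ≫ arrowSnd V f h =
    (arrowSnd V f g ⊗ₘ arrowSnd V g h) ≫ eComp V _ _ _ :=
  arrowLift_snd _ _ _ _

/-- The element of `C^2(f, g)` given by a commutative square. -/
noncomputable def arrowElt {f g : Arrow C} (h : f ⟶ g) : 𝟙_ V ⟶ arrowHom V f g :=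
  arrowLift V (eHomEquiv V h.left) (eHomEquiv V h.right) (by
    rw [eHomEquiv_whiskerLeft, eHomEquiv_whiskerRight, Arrow.w])

@[simp]
lemma arrowElt_fst {f g : Arrow C} (h : f ⟶ g) :
    arrowElt V h ≫ arrowFst V f g = eHomEquiv V h.left := arrowLift_fst _ _ _ _

@[simp]
lemma arrowElt_snd {f g : Arrow C} (h : f ⟶ g) :
    arrowElt V h ≫ arrowSnd V f g = eHomEquiv V h.right := arrowLift_snd _ _ _ _

lemma arrowElt_id (f : Arrow C) : arrowElt V (𝟙 f) = arrowId V f := by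
  apply arrowHom_ext
  · rw [arrowElt_fst, arrowId_fst, Arrow.id_left, eHomEquiv_id]
  · rw [arrowElt_snd, arrowId_snd, Arrow.id_right, eHomEquiv_id]

lemma arrowElt_comp {f g h : Arrow C} (a : f ⟶ g) (b : g ⟶ h) :
    arrowElt V (a ≫ b) =
      (λ_ _).inv ≫ (arrowElt V a ⊗ₘ arrowElt V b) ≫ arrowComp V f g h := by
  apply arrowHom_ext
  · rw [arrowElt_fst, Category.assoc, Category.assoc, arrowComp_fst,
      tensorHom_comp_tensorHom_assoc, arrowElt_fst, arrowElt_fst, Arrow.comp_left, eHomEquiv_comp]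
  · rw [arrowElt_snd, Category.assoc, Category.assoc, arrowComp_snd,
      tensorHom_comp_tensorHom_assoc, arrowElt_snd, arrowElt_snd, Arrow.comp_right, eHomEquiv_comp]

/-- Commutative squares `f ⟶ g` are the elements of `C^2(f, g)`. -/
noncomputable def arrowHomEquiv (f g : Arrow C) : (f ⟶ g) ≃ (𝟙_ V ⟶ arrowHom V f g) where
  toFun h := arrowElt V h
  invFun h := Arrow.homMk ((eHomEquiv V).symm (h ≫ arrowFst V f g))
    ((eHomEquiv V).symm (h ≫ arrowSnd V f g)) (by
      apply (eHomEquiv V).injective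
      rw [← eHomEquiv_whiskerLeft, ← eHomEquiv_whiskerRight]
      simp [arrow_condition])
  left_inv h := by ext <;> simp
  right_inv h := by apply arrowHom_ext <;> simp

/-- The `V`-category `C^2` of arrows of `C`; its underlying category is `Arrow C`. -/
noncomputable instance arrowEnriched : EnrichedOrdinaryCategory V (Arrow C) where
  Hom f g := arrowHom V f g
  id f := arrowId V f
  comp f g h := arrowComp V f g h
  id_comp f g := by
    apply arrowHom_ext
    · rw [Category.assoc, Category.assoc, arrowComp_fst, ← tensorHom_id,
        tensorHom_comp_tensorHom_assoc, arrowId_fst, Category.id_comp, aux_id_comp]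
    · rw [Category.assoc, Category.assoc, arrowComp_snd, ← tensorHom_id,
        tensorHom_comp_tensorHom_assoc, arrowId_snd, Category.id_comp, aux_id_comp]
  comp_id f g := by
    apply arrowHom_ext
    · rw [Category.assoc, Category.assoc, arrowComp_fst, ← id_tensorHom,
        tensorHom_comp_tensorHom_assoc, arrowId_fst, Category.id_comp, aux_comp_id]
    · rw [Category.assoc, Category.assoc, arrowComp_snd, ← id_tensorHom,
        tensorHom_comp_tensorHom_assoc, arrowId_snd, Category.id_comp, aux_comp_id]
  assoc f g h k := by
    apply arrowHom_ext
    · rw [Category.assoc, Category.assoc, arrowComp_fst, ← tensorHom_id,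
        tensorHom_comp_tensorHom_assoc, arrowComp_fst, Category.id_comp, aux_assoc,
        Category.assoc, arrowComp_fst, ← id_tensorHom, tensorHom_comp_tensorHom_assoc,
        arrowComp_fst, Category.id_comp]
    · rw [Category.assoc, Category.assoc, arrowComp_snd, ← tensorHom_id,
        tensorHom_comp_tensorHom_assoc, arrowComp_snd, Category.id_comp, aux_assoc,
        Category.assoc, arrowComp_snd, ← id_tensorHom, tensorHom_comp_tensorHom_assoc,
        arrowComp_snd, Category.id_comp]
  homEquiv {f g} := arrowHomEquiv V f g
  homEquiv_id f := arrowElt_id V f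
  homEquiv_comp a b := arrowElt_comp V a b

end Arrow

/-! ### `V`-functors and `V`-natural transformations -/

section Functors

variable (V : Type u₁) [Category.{v₁} V] [MonoidalCategory V]

section Underlying

variable {V}
variable {D : Type u₂} [Category.{v₂} D] [EnrichedOrdinaryCategory V D]
variable {C : Type u₃} [Category.{v₃} C] [EnrichedOrdinaryCategory V C]

/-- The action of a `V`-functor on the morphisms of the underlying categories. -/
def mapHom (F : EnrichedFunctor V D C) {X Y : D} (f : X ⟶ Y) : F.obj X ⟶ F.obj Y :=
  (eHomEquiv V).symm (eHomEquiv V f ≫ F.map X Y)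

@[simp]
lemma eHomEquiv_mapHom (F : EnrichedFunctor V D C) {X Y : D} (f : X ⟶ Y) :
    eHomEquiv V (mapHom F f) = eHomEquiv V f ≫ F.map X Y := by simp [mapHom]

@[simp]
lemma mapHom_id (F : EnrichedFunctor V D C) (X : D) : mapHom F (𝟙 X) = 𝟙 (F.obj X) :=
  (eHomEquiv V).injective (by simp)

@[simp]
lemma mapHom_comp (F : EnrichedFunctor V D C) {X Y Z : D} (f : X ⟶ Y) (g : Y ⟶ Z) :
    mapHom F (f ≫ g) = mapHom F f ≫ mapHom F g :=
  (eHomEquiv V).injective (by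
    simp only [eHomEquiv_mapHom, eHomEquiv_comp, Category.assoc, EnrichedFunctor.map_comp,
      tensorHom_comp_tensorHom_assoc])

/-- The functor of underlying categories of a `V`-functor. -/
@[simps]
def underlying (F : EnrichedFunctor V D C) : D ⥤ C where
  obj X := F.obj X
  map f := mapHom F f
  map_id X := mapHom_id F X
  map_comp f g := mapHom_comp F f g

end Underlying

/-- `V`-naturality of a family `τ d : F d ⟶ G d`: the two maps `D(d, d') ⟶ C(F d, G d')`
agree. -/
def IsVNatural {D : Type u₂} [EnrichedCategory V D] {C : Type u₃} [Category.{v₃} C]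
    [EnrichedOrdinaryCategory V C] (F G : EnrichedFunctor V D C)
    (τ : ∀ d, F.obj d ⟶ G.obj d) : Prop :=
  ∀ d d' : D, F.map d d' ≫ eHomWhiskerLeft V (F.obj d) (τ d') =
    G.map d d' ≫ eHomWhiskerRight V (τ d) (G.obj d')

variable [HasPullbacks V]

section Arrow

variable (C : Type u₃) [Category.{v₃} C] [EnrichedOrdinaryCategory V C]

/-- The domain `V`-functor `C^2 ⟶ C`. -/
noncomputable def domFunctor : EnrichedFunctor V (Arrow C) C where
  obj f := f.left
  map f g := arrowFst V f g
  map_id f := arrowId_fst V f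
  map_comp f g h := arrowComp_fst V f g h

/-- The codomain `V`-functor `C^2 ⟶ C`. -/
noncomputable def codFunctor : EnrichedFunctor V (Arrow C) C where
  obj f := f.right
  map f g := arrowSnd V f g
  map_id f := arrowId_snd V f
  map_comp f g h := arrowComp_snd V f g h

variable {V C}
variable {D : Type u₂} [EnrichedCategory V D]

/-- A `V`-natural transformation `τ : F ⟶ G : D ⟶ C`, as a `V`-functor `D ⟶ C^2`. -/
noncomputable def toArrow (F G : EnrichedFunctor V D C) (τ : ∀ d, F.obj d ⟶ G.obj d)
    (h : IsVNatural V F G τ) : EnrichedFunctor V D (Arrow C) where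
  obj d := Arrow.mk (τ d)
  map d d' := arrowLift V (F.map d d') (G.map d d') (h d d')
  map_id d := by
    apply arrowHom_ext
    · exact ((Category.assoc _ _ _).trans (by rw [arrowLift_fst]; exact F.map_id d)).trans
        (arrowId_fst V (Arrow.mk (τ d))).symm
    · exact ((Category.assoc _ _ _).trans (by rw [arrowLift_snd]; exact G.map_id d)).trans
        (arrowId_snd V (Arrow.mk (τ d))).symm
  map_comp d d' d'' := by
    apply arrowHom_ext
    · refine ((Category.assoc _ _ _).trans (by rw [arrowLift_fst, F.map_comp])).trans
        (((Category.assoc _ _ _).trans ?_).symm)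
      refine (congrArg _ (arrowComp_fst V _ _ _)).trans ?_
      rw [tensorHom_comp_tensorHom_assoc, arrowLift_fst, arrowLift_fst]
      rfl
    · refine ((Category.assoc _ _ _).trans (by rw [arrowLift_snd, G.map_comp])).trans
        (((Category.assoc _ _ _).trans ?_).symm)
      refine (congrArg _ (arrowComp_snd V _ _ _)).trans ?_
      rw [tensorHom_comp_tensorHom_assoc, arrowLift_snd, arrowLift_snd]
      rfl

end Arrow

end Functors

section Representables

open scoped MonoidalClosed

variable {V : Type u₁} [Category.{v₁} V] [MonoidalCategory V] [MonoidalClosed V]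

lemma uncurry_self_comp {A B X Y Z : V} (a : A ⟶ (ihom X).obj Y) (b : B ⟶ (ihom Y).obj Z) :
    MonoidalClosed.uncurry ((a ⊗ₘ b) ≫ MonoidalClosed.comp X Y Z) =
      (α_ X A B).inv ≫ (MonoidalClosed.uncurry a) ▷ B ≫ MonoidalClosed.uncurry b := by
  rw [MonoidalClosed.uncurry_natural_left, MonoidalClosed.comp_eq, MonoidalClosed.uncurry_curry,
    MonoidalClosed.compTranspose_eq, MonoidalClosed.uncurry_eq, MonoidalClosed.uncurry_eq]
  simp only [MonoidalCategory.tensorHom_def, MonoidalCategory.whiskerLeft_comp, comp_whiskerRight,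
    Category.assoc]
  rw [associator_inv_naturality_right_assoc, associator_inv_naturality_middle_assoc,
    whisker_exchange_assoc]
  rfl

variable {C : Type u₃}

/-- The covariant representable `C(A, -) : C ⟶ V`. -/
def covHom [EnrichedCategory V C] (A : C) : EnrichedFunctor V C V where
  obj X := A ⟶[V] X
  map X Y := MonoidalClosed.curry (eComp V A X Y)
  map_id X := by
    apply MonoidalClosed.uncurry_injective
    rw [MonoidalClosed.uncurry_natural_left, MonoidalClosed.uncurry_curry]
    refine Eq.trans ?_ (MonoidalClosed.uncurry_curry _).symm
    rw [← cancel_epi (ρ_ _).inv, e_comp_id, Iso.inv_hom_id]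
  map_comp X Y Z := by
    apply MonoidalClosed.uncurry_injective
    refine Eq.trans ?_ (uncurry_self_comp _ _).symm
    rw [MonoidalClosed.uncurry_natural_left, MonoidalClosed.uncurry_curry,
      MonoidalClosed.uncurry_curry, MonoidalClosed.uncurry_curry, e_assoc]

variable [BraidedCategory V]

lemma contra_aux (V : Type u₁) [Category.{v₁} V] [MonoidalCategory V] [BraidedCategory V]
    [EnrichedCategory V C] (A B D X : C) :
    (A ⟶[V] X) ◁ ((β_ (B ⟶[V] A) (D ⟶[V] B)).hom ≫ eComp V D B A) ≫
        (β_ (A ⟶[V] X) (D ⟶[V] A)).hom ≫ eComp V D A X =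
      (α_ _ _ _).inv ≫ ((β_ (A ⟶[V] X) (B ⟶[V] A)).hom ≫ eComp V B A X) ▷ (D ⟶[V] B) ≫
        (β_ (B ⟶[V] X) (D ⟶[V] B)).hom ≫ eComp V D B X := by
  rw [MonoidalCategory.whiskerLeft_comp, Category.assoc,
    BraidedCategory.braiding_naturality_right_assoc, comp_whiskerRight, Category.assoc,
    BraidedCategory.braiding_naturality_left_assoc, ← e_assoc',
    BraidedCategory.braiding_tensor_right_hom, BraidedCategory.braiding_tensor_left_hom]
  simp only [Category.assoc, Iso.inv_hom_id_assoc]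
  rw [← BraidedCategory.yang_baxter_assoc]

/-- The contravariant representable `C(-, X) : C^op ⟶ V`. -/
def contraHom [EnrichedCategory V C] (X : C) : EnrichedFunctor V Cᵒᵖ V where
  obj A := A.unop ⟶[V] X
  map A B := MonoidalClosed.curry ((β_ _ _).hom ≫ eComp V B.unop A.unop X)
  map_id A := by
    apply MonoidalClosed.uncurry_injective
    rw [MonoidalClosed.uncurry_natural_left, MonoidalClosed.uncurry_curry]
    refine Eq.trans ?_ (MonoidalClosed.uncurry_curry _).symm
    rw [BraidedCategory.braiding_naturality_right_assoc, braiding_tensorUnit_right,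
      Category.assoc]
    erw [e_id_comp]
    exact Category.comp_id _
  map_comp A B C := by
    apply MonoidalClosed.uncurry_injective
    refine Eq.trans ?_ (uncurry_self_comp _ _).symm
    rw [MonoidalClosed.uncurry_natural_left, MonoidalClosed.uncurry_curry,
      MonoidalClosed.uncurry_curry, MonoidalClosed.uncurry_curry]
    exact contra_aux V _ _ _ _

/-- The opposite of a `V`-functor. -/
def opFunctor {D : Type u₂} [EnrichedCategory V D] [EnrichedCategory V C]
    (F : EnrichedFunctor V D C) : EnrichedFunctor V Dᵒᵖ Cᵒᵖ where
  obj d := Opposite.op (F.obj d.unop)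
  map d d' := F.map d'.unop d.unop
  map_id d := F.map_id d.unop
  map_comp d d' d'' := by
    rw [eComp_op_eq, tensorHom_eComp_op_eq, Category.assoc, F.map_comp]
    rfl

end Representables

/-! ### The maps `C(cod g, dom f) ⟶ C^2(g, f)` -/

section Diag

variable (V : Type u₁) [Category.{v₁} V] [MonoidalCategory V] [HasPullbacks V]
variable {C : Type u₂} [Category.{v₂} C] [EnrichedOrdinaryCategory V C]

/-- The morphism `C(cod g, dom f) ⟶ C^2(g, f)`, `k ↦ (k ∘ g, f ∘ k)`. It is the morphism
`C^2(g, (1, f)) : C^2(g, 1_{dom f}) ⟶ C^2(g, f)`, with `C^2(g, 1_X)` written as `C(cod g, X)`. -/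
noncomputable def arrowDiag (g f : Arrow C) : (g.right ⟶[V] f.left) ⟶ arrowHom V g f :=
  arrowLift V (eHomWhiskerRight V g.hom f.left) (eHomWhiskerLeft V g.right f.hom)
    (eHom_whisker_exchange V g.hom f.hom).symm

@[simp]
lemma arrowDiag_fst (g f : Arrow C) :
    arrowDiag V g f ≫ arrowFst V g f = eHomWhiskerRight V g.hom f.left := arrowLift_fst _ _ _ _

@[simp]
lemma arrowDiag_snd (g f : Arrow C) :
    arrowDiag V g f ≫ arrowSnd V g f = eHomWhiskerLeft V g.right f.hom := arrowLift_snd _ _ _ _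

lemma arrowDiag_left (g' g f : Arrow C) :
    arrowSnd V g' g ▷ (g.right ⟶[V] f.left) ≫ eComp V g'.right g.right f.left ≫
        arrowDiag V g' f =
      (arrowHom V g' g) ◁ arrowDiag V g f ≫ arrowComp V g' g f := by
  apply arrowHom_ext
  · simp only [Category.assoc, arrowDiag_fst, arrowComp_fst]
    rw [eComp_eHomWhiskerRight, ← comp_whiskerRight_assoc, ← arrow_condition,
      ← id_tensorHom, tensorHom_comp_tensorHom_assoc, arrowDiag_fst, Category.id_comp,
      ← tensorHom_id]
    have h := eComp_dinatural (V := V) g'.left f.left g.hom (arrowFst V g' g) (𝟙 _)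
    rw [Category.id_comp] at h
    exact h.symm
  · simp only [Category.assoc, arrowDiag_snd, arrowComp_snd]
    rw [eComp_eHomWhiskerLeft, ← id_tensorHom, ← tensorHom_id, ← id_tensorHom,
      tensorHom_comp_tensorHom_assoc, tensorHom_comp_tensorHom_assoc, arrowDiag_snd]
    simp only [Category.id_comp, Category.comp_id]

lemma arrowDiag_right (g f f' : Arrow C) :
    (g.right ⟶[V] f.left) ◁ arrowFst V f f' ≫ eComp V g.right f.left f'.left ≫
        arrowDiag V g f' =
      arrowDiag V g f ▷ (arrowHom V f f') ≫ arrowComp V g f f' := by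
  apply arrowHom_ext
  · simp only [Category.assoc, arrowDiag_fst, arrowComp_fst]
    rw [eComp_eHomWhiskerRight, ← id_tensorHom, ← tensorHom_id, ← tensorHom_id,
      tensorHom_comp_tensorHom_assoc, tensorHom_comp_tensorHom_assoc, arrowDiag_fst]
    simp only [Category.id_comp, Category.comp_id]
  · simp only [Category.assoc, arrowDiag_snd, arrowComp_snd]
    rw [eComp_eHomWhiskerLeft, ← id_tensorHom, ← id_tensorHom, ← tensorHom_id,
      tensorHom_comp_tensorHom_assoc, tensorHom_comp_tensorHom_assoc, arrowDiag_snd,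
      arrow_condition]
    have h := eComp_dinatural (V := V) g.right f'.right f.hom (𝟙 _) (arrowSnd V f f')
    simp only [Category.id_comp] at h ⊢
    exact h

end Diag

section W

open scoped MonoidalClosed

variable {V : Type u₁} [Category.{v₁} V] [MonoidalCategory V] [MonoidalClosed V]

lemma isVNatural_of_uncurry {D : Type u₂} [EnrichedCategory V D]
    (F G : EnrichedFunctor V D V) (τ : ∀ d, F.obj d ⟶ G.obj d)
    (h : ∀ d d', MonoidalClosed.uncurry (F.map d d') ≫ τ d' =
      τ d ▷ _ ≫ MonoidalClosed.uncurry (G.map d d')) : IsVNatural V F G τ := by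
  intro d d'
  rw [MonoidalClosed.enrichedOrdinaryCategorySelf_eHomWhiskerLeft,
    MonoidalClosed.enrichedOrdinaryCategorySelf_eHomWhiskerRight]
  apply MonoidalClosed.uncurry_injective
  refine (MonoidalClosed.uncurry_natural_right _ _).trans ((h d d').trans ?_)
  exact (MonoidalClosed.uncurry_pre_app (A := G.obj d) (B := F.obj d) (X := G.obj d')
    (G.map d d') (τ d)).symm

variable [BraidedCategory V] [HasPullbacks V]
variable (V)
variable {C : Type u₂} [Category.{v₂} C] [EnrichedOrdinaryCategory V C]

lemma braid_aux (V : Type u₁) [Category.{v₁} V] [MonoidalCategory V] [BraidedCategory V]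
    {P Q A B X Y : V} {a : A ⟶ B} {b : P ⟶ Q} {c : B ⊗ P ⟶ X} {d : X ⟶ Y}
    {e : A ⊗ Q ⟶ Y} (h : a ▷ P ≫ c ≫ d = A ◁ b ≫ e) :
    (P ◁ a ≫ (β_ P B).hom ≫ c) ≫ d = b ▷ A ≫ (β_ Q A).hom ≫ e := by
  rw [Category.assoc, Category.assoc, BraidedCategory.braiding_naturality_right_assoc, h,
    BraidedCategory.braiding_naturality_left_assoc]

/-- For a fixed `f`, the `V`-functor `(C^2)^op ⟶ V^2` sending `g` to the arrow
`C(cod g, dom f) ⟶ C^2(g, f)`. -/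
noncomputable def diagContra (f : Arrow C) : EnrichedFunctor V (Arrow C)ᵒᵖ (Arrow V) :=
  toArrow ((opFunctor (codFunctor V C)).comp V (contraHom f.left)) (contraHom f)
    (fun g => arrowDiag V g.unop f) (isVNatural_of_uncurry _ _ _ fun g g' => by
      have h := arrowDiag_left V g'.unop g.unop f
      refine (congrArg (· ≫ arrowDiag V g'.unop f)
        ((MonoidalClosed.uncurry_natural_left _ _).trans
          (congrArg _ (MonoidalClosed.uncurry_curry _)))).trans ?_
      refine Eq.trans ?_ (congrArg _ (MonoidalClosed.uncurry_curry _).symm)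
      exact braid_aux V h)

/-- For a fixed `g`, the `V`-functor `C^2 ⟶ V^2` sending `f` to the arrow
`C(cod g, dom f) ⟶ C^2(g, f)`. -/
noncomputable def diagCov (g : Arrow C) : EnrichedFunctor V (Arrow C) (Arrow V) :=
  toArrow ((domFunctor V C).comp V (covHom g.right)) (covHom g)
    (fun f => arrowDiag V g f) (isVNatural_of_uncurry _ _ _ fun f f' => by
      have h := arrowDiag_right V g f f'
      refine (congrArg (· ≫ arrowDiag V g f')
        ((MonoidalClosed.uncurry_natural_left _ _).trans
          (congrArg _ (MonoidalClosed.uncurry_curry _)))).trans ?_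
      refine Eq.trans ?_ (congrArg _ (MonoidalClosed.uncurry_curry _).symm)
      exact (Category.assoc _ _ _).trans h)

end W

/-! ### Enriched algebraic weak factorisation systems -/

section AWFS

variable (V : Type u₁) [Category.{v₁} V] [MonoidalCategory V] [HasPullbacks V]
variable (C : Type u₂) [Category.{v₂} C] [EnrichedOrdinaryCategory V C]

/-- A `V`-functorial factorisation `f = ρ_f ∘ λ_f` on `C`, through `K f`. -/
structure FunctorialFactorisation where
  /-- The `V`-functor `K : C^2 ⟶ C`. -/
  K : EnrichedFunctor V (Arrow C) C
  /-- The `V`-natural transformation `λ : dom ⟶ K`. -/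
  lam (f : Arrow C) : f.left ⟶ K.obj f
  /-- The `V`-natural transformation `ρ : K ⟶ cod`. -/
  rho (f : Arrow C) : K.obj f ⟶ f.right
  lam_natural : IsVNatural V (domFunctor V C) K lam
  rho_natural : IsVNatural V K (codFunctor V C) rho
  lam_rho (f : Arrow C) : lam f ≫ rho f = f.hom

lemma mapHom_natural {V : Type u₁} [Category.{v₁} V] [MonoidalCategory V]
    {D : Type u₂} [Category.{v₂} D] [EnrichedOrdinaryCategory V D]
    {C : Type u₃} [Category.{v₃} C] [EnrichedOrdinaryCategory V C]
    (F G : EnrichedFunctor V D C) (τ : ∀ d, F.obj d ⟶ G.obj d) (hτ : IsVNatural V F G τ)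
    {d d' : D} (f : d ⟶ d') (g : F.obj d ⟶ F.obj d')
    (hg : eHomEquiv V f ≫ F.map d d' = eHomEquiv V g) :
    τ d ≫ mapHom G f = g ≫ τ d' := by
  apply (eHomEquiv V).injective
  rw [← eHomEquiv_whiskerRight, ← eHomEquiv_whiskerLeft, eHomEquiv_mapHom, Category.assoc,
    ← hτ, ← hg, Category.assoc]

lemma mapHom_natural' {V : Type u₁} [Category.{v₁} V] [MonoidalCategory V]
    {D : Type u₂} [Category.{v₂} D] [EnrichedOrdinaryCategory V D]
    {C : Type u₃} [Category.{v₃} C] [EnrichedOrdinaryCategory V C]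
    (F G : EnrichedFunctor V D C) (τ : ∀ d, F.obj d ⟶ G.obj d) (hτ : IsVNatural V F G τ)
    {d d' : D} (f : d ⟶ d') (g : G.obj d ⟶ G.obj d')
    (hg : eHomEquiv V f ≫ G.map d d' = eHomEquiv V g) :
    mapHom F f ≫ τ d' = τ d ≫ g := by
  apply (eHomEquiv V).injective
  rw [← eHomEquiv_whiskerLeft, ← eHomEquiv_whiskerRight, eHomEquiv_mapHom, Category.assoc,
    hτ, ← hg, Category.assoc]

namespace FunctorialFactorisation

variable {V C} (𝓕 : FunctorialFactorisation V C)

/-- The endo-`V`-functor `f ↦ λ_f` of `C^2`. -/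
noncomputable def L : EnrichedFunctor V (Arrow C) (Arrow C) :=
  toArrow (domFunctor V C) 𝓕.K 𝓕.lam 𝓕.lam_natural

/-- The endo-`V`-functor `f ↦ ρ_f` of `C^2`. -/
noncomputable def R : EnrichedFunctor V (Arrow C) (Arrow C) :=
  toArrow 𝓕.K (codFunctor V C) 𝓕.rho 𝓕.rho_natural

/-- The action of `K` on commutative squares. -/
noncomputable def Kmap {f g : Arrow C} (h : f ⟶ g) : 𝓕.K.obj f ⟶ 𝓕.K.obj g := mapHom 𝓕.K h

lemma lam_Kmap {f g : Arrow C} (h : f ⟶ g) :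
    𝓕.lam f ≫ 𝓕.Kmap h = h.left ≫ 𝓕.lam g :=
  mapHom_natural (domFunctor V C) 𝓕.K 𝓕.lam 𝓕.lam_natural h h.left (arrowElt_fst V h)

lemma Kmap_rho {f g : Arrow C} (h : f ⟶ g) :
    𝓕.rho f ≫ h.right = 𝓕.Kmap h ≫ 𝓕.rho g := by
  have h1 := mapHom_natural' 𝓕.K (codFunctor V C) 𝓕.rho 𝓕.rho_natural h h.right
    (arrowElt_snd V h)
  exact h1.symm

end FunctorialFactorisation

/-- A `V`-enriched algebraic weak factorisation system on `C`. The comultiplication of the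
comonad on `L` has components `(1, σ_f)`, the multiplication of the monad on `R` has components
`(π_f, 1)`; the counit and the unit are `(1, ρ_f)` and `(λ_f, 1)`. -/
structure AWFS extends FunctorialFactorisation V C where
  sigma (f : Arrow C) : K.obj f ⟶ K.obj (Arrow.mk (lam f))
  pi (f : Arrow C) : K.obj (Arrow.mk (rho f)) ⟶ K.obj f
  sigma_natural : IsVNatural V K (toFunctorialFactorisation.L.comp V K) sigma
  pi_natural : IsVNatural V (toFunctorialFactorisation.R.comp V K) K pi
  lam_sigma (f : Arrow C) : lam f ≫ sigma f = lam (Arrow.mk (lam f))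
  pi_rho (f : Arrow C) : pi f ≫ rho f = rho (Arrow.mk (rho f))
  counit_left (f : Arrow C) : sigma f ≫ rho (Arrow.mk (lam f)) = 𝟙 _
  counit_right (f : Arrow C) : sigma f ≫ toFunctorialFactorisation.Kmap
      (Arrow.homMk (f := Arrow.mk (lam f)) (g := f) (𝟙 _) (rho f)
        ((Category.id_comp _).trans (lam_rho f).symm)) = 𝟙 _
  coassoc (f : Arrow C) : sigma f ≫ sigma (Arrow.mk (lam f)) =
    sigma f ≫ toFunctorialFactorisation.Kmap
      (Arrow.homMk (f := Arrow.mk (lam f)) (g := Arrow.mk (lam (Arrow.mk (lam f))))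
        (𝟙 _) (sigma f) ((Category.id_comp _).trans (lam_sigma f).symm))
  unit_left (f : Arrow C) : lam (Arrow.mk (rho f)) ≫ pi f = 𝟙 _
  unit_right (f : Arrow C) : toFunctorialFactorisation.Kmap
      (Arrow.homMk (f := f) (g := Arrow.mk (rho f)) (lam f) (𝟙 _)
        ((lam_rho f).trans (Category.comp_id _).symm)) ≫ pi f = 𝟙 _
  assoc (f : Arrow C) : toFunctorialFactorisation.Kmap
      (Arrow.homMk (f := Arrow.mk (rho (Arrow.mk (rho f)))) (g := Arrow.mk (rho f))
        (pi f) (𝟙 _) ((pi_rho f).trans (Category.comp_id _).symm)) ≫ pi f =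
    pi (Arrow.mk (rho f)) ≫ pi f
  /-- `(σ_f, π_f) : L R f ⟶ R L f` is a mixed distributive law. -/
  distrib (f : Arrow C) : pi f ≫ sigma f = sigma (Arrow.mk (rho f)) ≫
    toFunctorialFactorisation.Kmap
      (Arrow.homMk (f := Arrow.mk (lam (Arrow.mk (rho f))))
        (g := Arrow.mk (rho (Arrow.mk (lam f)))) (sigma f) (pi f)
        ((counit_left f).trans (unit_left f).symm)) ≫ pi (Arrow.mk (lam f))

namespace AWFS

variable {V C} (𝓐 : AWFS V C)

/-- `p` is an algebra structure `(p, 1) : R g ⟶ g` for the monad on `R`. -/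
structure IsAlg (g : Arrow C) (p : 𝓐.K.obj g ⟶ g.left) : Prop where
  comp_hom : p ≫ g.hom = 𝓐.rho g
  unit : 𝓐.lam g ≫ p = 𝟙 _
  assoc : 𝓐.Kmap (Arrow.homMk (f := Arrow.mk (𝓐.rho g)) (g := g) p (𝟙 _)
    (comp_hom.trans (Category.comp_id _).symm)) ≫ p = 𝓐.pi g ≫ p

/-- The structure map of the composite of an algebra `(f, p)` followed by an algebra `(g, q)`. -/
noncomputable def compStr {X Y Z : C} (f : X ⟶ Y) (g : Y ⟶ Z) (k : X ⟶ Z) (hk : f ≫ g = k)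
    (p : 𝓐.K.obj (Arrow.mk f) ⟶ X) (q : 𝓐.K.obj (Arrow.mk g) ⟶ Y)
    (hq : 𝓐.lam (Arrow.mk g) ≫ q = 𝟙 Y) : 𝓐.K.obj (Arrow.mk k) ⟶ X :=
  𝓐.sigma (Arrow.mk k) ≫ 𝓐.Kmap (Arrow.homMk (f := Arrow.mk (𝓐.lam (Arrow.mk k)))
    (g := Arrow.mk f) (𝟙 X)
    (𝓐.Kmap (Arrow.homMk (f := Arrow.mk k) (g := Arrow.mk g) f (𝟙 Z)
      (by simpa using hk)) ≫ q) (by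
      refine (Category.id_comp _).trans (Eq.symm ?_)
      refine (Category.assoc _ _ _).symm.trans ?_
      refine (congrArg (· ≫ q) (𝓐.lam_Kmap _)).trans ?_
      refine (Category.assoc _ _ _).trans ?_
      exact (congrArg (f ≫ ·) hq).trans (Category.comp_id f))) ≫ p

/-- An AWFS is cocontinuous when the functor `K` preserves small colimits. -/
def Cocontinuous : Prop :=
  PreservesColimitsOfSize.{w, w} (underlying 𝓐.K)

end AWFS

end AWFS

/-! ### Inserters -/

section Inserter

variable {V : Type u₁} [Category.{v₁} V] [MonoidalCategory V]
variable {D : Type u₂} [Category.{v₂} D] [EnrichedOrdinaryCategory V D]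
variable {E : Type u₃} [Category.{v₃} E] [EnrichedOrdinaryCategory V E]

/-- Objects of the inserter of a family of pairs of `V`-functors `F i, G i : D ⟶ E`: an object
`x` of `D` with a morphism `F i x ⟶ G i x` for each `i`. -/
structure Inserter {I : Type w} (F G : I → EnrichedFunctor V D E) where
  obj : D
  str (i : I) : (F i).obj obj ⟶ (G i).obj obj

namespace Inserter

variable {I : Type w} {F G : I → EnrichedFunctor V D E}

/-- Morphisms of the inserter: morphisms of `D` that commute with the structures. -/
@[ext]
structure Hom (x y : Inserter F G) where
  hom : x.obj ⟶ y.obj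
  comm (i : I) : mapHom (F i) hom ≫ y.str i = x.str i ≫ mapHom (G i) hom

instance : Category (Inserter F G) where
  Hom := Hom
  id x := ⟨𝟙 _, fun i => by
    rw [mapHom_id, mapHom_id, Category.id_comp, Category.comp_id]⟩
  comp f g := ⟨f.hom ≫ g.hom, fun i => by
    rw [mapHom_comp, mapHom_comp, Category.assoc, g.comm, ← Category.assoc, f.comm, Category.assoc]⟩
  id_comp f := Hom.ext (Category.id_comp _)
  comp_id f := Hom.ext (Category.comp_id _)
  assoc f g h := Hom.ext (Category.assoc _ _ _)

/-- The forgetful functor from the inserter. -/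
@[simps]
def forget (F G : I → EnrichedFunctor V D E) : Inserter F G ⥤ D where
  obj x := x.obj
  map f := f.hom

/-- The two maps `D(x, y) ⟶ E(F i x, G i y)` agree along `a`. -/
def Commutes {x y : Inserter F G} {A : V} (a : A ⟶ (x.obj ⟶[V] y.obj)) : Prop :=
  ∀ i, a ≫ (F i).map _ _ ≫ eHomWhiskerLeft V _ (y.str i) =
    a ≫ (G i).map _ _ ≫ eHomWhiskerRight V (x.str i) _

lemma commutes_id (x : Inserter F G) : Commutes (x := x) (y := x) (eId V x.obj) := fun i => by
  rw [EnrichedFunctor.map_id_assoc, EnrichedFunctor.map_id_assoc, ← eHomEquiv_id, ← eHomEquiv_id,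
    eHomEquiv_whiskerLeft, eHomEquiv_whiskerRight, Category.id_comp, Category.comp_id]

lemma commutes_comp {x y z : Inserter F G} {A B : V} {a : A ⟶ (x.obj ⟶[V] y.obj)}
    {b : B ⟶ (y.obj ⟶[V] z.obj)} (ha : Commutes (x := x) (y := y) a)
    (hb : Commutes (x := y) (y := z) b) :
    Commutes (x := x) (y := z) ((a ⊗ₘ b) ≫ eComp V _ _ _) := fun i => by
  have e1 : ((a ≫ (F i).map _ _) ⊗ₘ (b ≫ (F i).map _ _)) ≫ _ ◁ eHomWhiskerLeft V _ (z.str i) =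
      (a ≫ (F i).map _ _) ⊗ₘ ((b ≫ (G i).map _ _) ≫ eHomWhiskerRight V (y.str i) _) := by
    rw [Category.assoc b, ← hb i, ← id_tensorHom, tensorHom_comp_tensorHom, Category.comp_id,
      Category.assoc]
  have e2 : ((a ≫ (G i).map _ _) ⊗ₘ (b ≫ (G i).map _ _)) ≫ eHomWhiskerRight V (x.str i) _ ▷ _ =
      ((a ≫ (F i).map _ _) ≫ eHomWhiskerLeft V _ (y.str i)) ⊗ₘ (b ≫ (G i).map _ _) := by
    rw [Category.assoc a, ha i, ← tensorHom_id, tensorHom_comp_tensorHom, Category.comp_id,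
      Category.assoc]
  rw [Category.assoc, EnrichedFunctor.map_comp_assoc, tensorHom_comp_tensorHom_assoc,
    eComp_eHomWhiskerLeft, reassoc_of% e1, ← Category.assoc b, eComp_dinatural, Category.assoc (a ⊗ₘ b),
    EnrichedFunctor.map_comp_assoc,
    tensorHom_comp_tensorHom_assoc, eComp_eHomWhiskerRight, reassoc_of% e2, Category.assoc a]

lemma commutes_elt_iff {x y : Inserter F G} (f : x.obj ⟶ y.obj) :
    Commutes (x := x) (y := y) (eHomEquiv V f) ↔
      ∀ i, mapHom (F i) f ≫ y.str i = x.str i ≫ mapHom (G i) f := by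
  refine forall_congr' fun i => ?_
  rw [← Category.assoc, ← Category.assoc, ← eHomEquiv_mapHom, ← eHomEquiv_mapHom,
    eHomEquiv_whiskerLeft, eHomEquiv_whiskerRight, (eHomEquiv V).injective.eq_iff]

variable [HasEqualizers V] [HasProductsOfShape I V]

/-- The hom-object of the inserter: the equaliser of
`D(x, y) ⇉ ∏ i, E(F i x, G i y)`. -/
noncomputable def homObj (x y : Inserter F G) : V :=
  equalizer
    (Pi.lift fun i => (F i).map x.obj y.obj ≫ eHomWhiskerLeft V ((F i).obj x.obj) (y.str i))
    (Pi.lift fun i => (G i).map x.obj y.obj ≫ eHomWhiskerRight V (x.str i) ((G i).obj y.obj))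

/-- The inclusion of the hom-object of the inserter in that of `D`. -/
noncomputable def homIncl (x y : Inserter F G) : homObj x y ⟶ (x.obj ⟶[V] y.obj) :=
  equalizer.ι _ _

lemma commutes_homIncl (x y : Inserter F G) : Commutes (x := x) (y := y) (homIncl x y) :=
  fun i => by
    have h := congrArg (· ≫ Pi.π _ i) (equalizer.condition
      (Pi.lift fun i => (F i).map x.obj y.obj ≫ eHomWhiskerLeft V ((F i).obj x.obj) (y.str i))
      (Pi.lift fun i => (G i).map x.obj y.obj ≫
        eHomWhiskerRight V (x.str i) ((G i).obj y.obj)))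
    simp only [Category.assoc, Pi.lift_π] at h
    exact h

/-- The universal property of the hom-object of the inserter. -/
noncomputable def homLift {x y : Inserter F G} {A : V} (a : A ⟶ (x.obj ⟶[V] y.obj))
    (ha : Commutes (x := x) (y := y) a) : A ⟶ homObj x y :=
  equalizer.lift a (Pi.hom_ext _ _ fun i => by
    simpa only [Category.assoc, Pi.lift_π] using ha i)

@[simp]
lemma homLift_incl {x y : Inserter F G} {A : V} (a : A ⟶ (x.obj ⟶[V] y.obj))
    (ha : Commutes (x := x) (y := y) a) : homLift a ha ≫ homIncl x y = a :=
  equalizer.lift_ι _ _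

lemma homObj_ext {x y : Inserter F G} {A : V} {a b : A ⟶ homObj x y}
    (h : a ≫ homIncl x y = b ≫ homIncl x y) : a = b := equalizer.hom_ext h

/-- The composition of the inserter. -/
noncomputable def homComp (x y z : Inserter F G) : homObj x y ⊗ homObj y z ⟶ homObj x z :=
  homLift ((homIncl x y ⊗ₘ homIncl y z) ≫ eComp V _ _ _)
    (commutes_comp (commutes_homIncl x y) (commutes_homIncl y z))

@[simp]
lemma homComp_incl (x y z : Inserter F G) :
    homComp x y z ≫ homIncl x z = (homIncl x y ⊗ₘ homIncl y z) ≫ eComp V _ _ _ :=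
  homLift_incl _ _

/-- Morphisms of the inserter are the elements of its hom-objects. -/
noncomputable def homEquiv (x y : Inserter F G) : (x ⟶ y) ≃ (𝟙_ V ⟶ homObj x y) where
  toFun f := homLift (eHomEquiv V f.hom) ((commutes_elt_iff _).2 f.comm)
  invFun a := ⟨(eHomEquiv V).symm (a ≫ homIncl x y), (commutes_elt_iff _).1 (by
    rw [Equiv.apply_symm_apply]
    exact fun i => by rw [Category.assoc, commutes_homIncl x y i, Category.assoc])⟩
  left_inv f := Hom.ext (by simp)
  right_inv a := homObj_ext (by simp)

lemma homEquiv_incl {x y : Inserter F G} (f : x ⟶ y) :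
    homEquiv x y f ≫ homIncl x y = eHomEquiv V f.hom :=
  homLift_incl (eHomEquiv V f.hom) ((commutes_elt_iff f.hom).2 f.comm)

/-- The inserter as a `V`-category. -/
noncomputable instance enriched : EnrichedOrdinaryCategory V (Inserter F G) where
  Hom := homObj
  id x := homLift (eId V x.obj) (commutes_id x)
  comp := homComp
  id_comp x y := by
    apply homObj_ext
    rw [Category.assoc, Category.assoc, homComp_incl, ← tensorHom_id,
      tensorHom_comp_tensorHom_assoc, homLift_incl, Category.id_comp, aux_id_comp]
  comp_id x y := by
    apply homObj_ext
    rw [Category.assoc, Category.assoc, homComp_incl, ← id_tensorHom,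
      tensorHom_comp_tensorHom_assoc, homLift_incl, Category.id_comp, aux_comp_id]
  assoc w x y z := by
    apply homObj_ext
    rw [Category.assoc, Category.assoc, homComp_incl, ← tensorHom_id,
      tensorHom_comp_tensorHom_assoc, homComp_incl, Category.id_comp, aux_assoc,
      Category.assoc, homComp_incl, ← id_tensorHom, tensorHom_comp_tensorHom_assoc,
      homComp_incl, Category.id_comp]
  homEquiv {x y} := homEquiv x y
  homEquiv_id x := by
    apply homObj_ext
    rw [homEquiv_incl]
    exact (eHomEquiv_id V x.obj).trans (homLift_incl (eId V x.obj) (commutes_id x)).symm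
  homEquiv_comp {x y z} f g := by
    apply homObj_ext
    rw [homEquiv_incl]
    refine (eHomEquiv_comp V f.hom g.hom).trans ?_
    rw [Category.assoc, Category.assoc]
    refine congrArg _ (Eq.symm ((congrArg _ (homComp_incl x y z)).trans ?_))
    rw [tensorHom_comp_tensorHom_assoc, homEquiv_incl, homEquiv_incl]

end Inserter

end Inserter

/-! ### Internal categories in `V`-categories -/

section Internal

variable (V : Type u₁) [Category.{v₁} V] [MonoidalCategory V]

/-- The total type of a family of types of arrows. -/
structure TotalArr {O : Type w} (Ver : O → O → Type w) where
  src : O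
  tgt : O
  arr : Ver src tgt

/-- A graph internal to small `V`-categories: a `V`-category of objects, a `V`-category whose
objects are the (vertical) arrows, and source and target `V`-functors. The arrows are given by
the family of the types of arrows with prescribed source and target. -/
structure InternalGraph where
  Obj : Type w
  Ver : Obj → Obj → Type w
  [objCat : EnrichedCategory V Obj]
  [arrCat : EnrichedCategory V (TotalArr Ver)]
  /-- The source `V`-functor on hom-objects. -/
  srcMap (x y : TotalArr Ver) : (x ⟶[V] y) ⟶ (x.src ⟶[V] y.src)
  srcMap_id (x : TotalArr Ver) : eId V x ≫ srcMap x x = eId V x.src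
  srcMap_comp (x y z : TotalArr Ver) : eComp V x y z ≫ srcMap x z =
    (srcMap x y ⊗ₘ srcMap y z) ≫ eComp V x.src y.src z.src
  /-- The target `V`-functor on hom-objects. -/
  tgtMap (x y : TotalArr Ver) : (x ⟶[V] y) ⟶ (x.tgt ⟶[V] y.tgt)
  tgtMap_id (x : TotalArr Ver) : eId V x ≫ tgtMap x x = eId V x.tgt
  tgtMap_comp (x y z : TotalArr Ver) : eComp V x y z ≫ tgtMap x z =
    (tgtMap x y ⊗ₘ tgtMap y z) ≫ eComp V x.tgt y.tgt z.tgt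

attribute [instance] InternalGraph.objCat InternalGraph.arrCat

namespace InternalGraph

variable {V}
variable (J : InternalGraph.{v₁, u₁, w} V)

/-- The objects of the `V`-category of arrows. -/
abbrev Arr : Type w := TotalArr J.Ver

/-- An arrow `a ⟶ b`, as an object of the `V`-category of arrows. -/
abbrev ar {a b : J.Obj} (i : J.Ver a b) : J.Arr := ⟨a, b, i⟩

/-- The source `V`-functor. -/
def srcFunctor : EnrichedFunctor V J.Arr J.Obj where
  obj x := x.src
  map := J.srcMap
  map_id := J.srcMap_id
  map_comp := J.srcMap_comp

/-- The target `V`-functor. -/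
def tgtFunctor : EnrichedFunctor V J.Arr J.Obj where
  obj x := x.tgt
  map := J.tgtMap
  map_id := J.tgtMap_id
  map_comp := J.tgtMap_comp

variable [HasPullbacks V]

section Pair

variable {a b d a' b' d' a'' b'' d'' : J.Obj}

/-- The hom-object from `(i, j)` to `(i', j')` in the `V`-category of composable pairs, which is
the pullback of the target and the source `V`-functors. -/
noncomputable def pairHom (i : J.Ver a b) (j : J.Ver b d) (i' : J.Ver a' b') (j' : J.Ver b' d') :
    V :=
  pullback (J.tgtMap (J.ar i) (J.ar i')) (J.srcMap (J.ar j) (J.ar j'))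

/-- The first projection from the `V`-category of composable pairs. -/
noncomputable def pairFst (i : J.Ver a b) (j : J.Ver b d) (i' : J.Ver a' b') (j' : J.Ver b' d') :
    J.pairHom i j i' j' ⟶ (J.ar i ⟶[V] J.ar i') := pullback.fst _ _

/-- The second projection from the `V`-category of composable pairs. -/
noncomputable def pairSnd (i : J.Ver a b) (j : J.Ver b d) (i' : J.Ver a' b') (j' : J.Ver b' d') :
    J.pairHom i j i' j' ⟶ (J.ar j ⟶[V] J.ar j') := pullback.snd _ _

lemma pair_condition (i : J.Ver a b) (j : J.Ver b d) (i' : J.Ver a' b') (j' : J.Ver b' d') :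
    J.pairFst i j i' j' ≫ J.tgtMap (J.ar i) (J.ar i') =
      J.pairSnd i j i' j' ≫ J.srcMap (J.ar j) (J.ar j') := pullback.condition

/-- The universal property of the hom-objects of the `V`-category of composable pairs. -/
noncomputable def pairLift {i : J.Ver a b} {j : J.Ver b d} {i' : J.Ver a' b'} {j' : J.Ver b' d'}
    {T : V} (s : T ⟶ (J.ar i ⟶[V] J.ar i')) (t : T ⟶ (J.ar j ⟶[V] J.ar j'))
    (h : s ≫ J.tgtMap (J.ar i) (J.ar i') = t ≫ J.srcMap (J.ar j) (J.ar j')) :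
    T ⟶ J.pairHom i j i' j' := pullback.lift s t h

/-- The identities of the `V`-category of composable pairs. -/
noncomputable def pairId (i : J.Ver a b) (j : J.Ver b d) : 𝟙_ V ⟶ J.pairHom i j i j :=
  J.pairLift (eId V (J.ar i)) (eId V (J.ar j))
    ((J.tgtMap_id (J.ar i)).trans (J.srcMap_id (J.ar j)).symm)

/-- The composition of the `V`-category of composable pairs. -/
noncomputable def pairComp (i : J.Ver a b) (j : J.Ver b d) (i' : J.Ver a' b') (j' : J.Ver b' d')
    (i'' : J.Ver a'' b'') (j'' : J.Ver b'' d'') :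
    J.pairHom i j i' j' ⊗ J.pairHom i' j' i'' j'' ⟶ J.pairHom i j i'' j'' :=
  J.pairLift
    ((J.pairFst i j i' j' ⊗ₘ J.pairFst i' j' i'' j'') ≫ eComp V (J.ar i) (J.ar i') (J.ar i''))
    ((J.pairSnd i j i' j' ⊗ₘ J.pairSnd i' j' i'' j'') ≫ eComp V (J.ar j) (J.ar j') (J.ar j''))
    (by
      rw [Category.assoc, J.tgtMap_comp, tensorHom_comp_tensorHom_assoc, pair_condition,
        pair_condition, Category.assoc, J.srcMap_comp, tensorHom_comp_tensorHom_assoc])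

end Pair

end InternalGraph

variable [HasPullbacks V]

/-- A small category internal to `V`-categories: an internal graph with identities and
composition, given by `V`-functors over the `V`-category of objects, that satisfy the unit and
associativity laws, both on objects and on hom-objects. -/
structure InternalCat extends InternalGraph.{v₁, u₁, w} V where
  vid (a : Obj) : Ver a a
  vcomp {a b d : Obj} (i : Ver a b) (j : Ver b d) : Ver a d
  vid_vcomp {a b : Obj} (i : Ver a b) : vcomp (vid a) i = i
  vcomp_vid {a b : Obj} (i : Ver a b) : vcomp i (vid b) = i
  vcomp_assoc {a b d e : Obj} (i : Ver a b) (j : Ver b d) (k : Ver d e) :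
    vcomp (vcomp i j) k = vcomp i (vcomp j k)
  /-- The identity `V`-functor on hom-objects. -/
  vidMap (a a' : Obj) : (a ⟶[V] a') ⟶ (toInternalGraph.ar (vid a) ⟶[V] toInternalGraph.ar (vid a'))
  vidMap_id (a : Obj) : eId V a ≫ vidMap a a = eId V (toInternalGraph.ar (vid a))
  vidMap_comp (a a' a'' : Obj) : eComp V a a' a'' ≫ vidMap a a'' =
    (vidMap a a' ⊗ₘ vidMap a' a'') ≫ eComp V _ _ _
  vidMap_src (a a' : Obj) : vidMap a a' ≫ srcMap _ _ = 𝟙 (a ⟶[V] a')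
  vidMap_tgt (a a' : Obj) : vidMap a a' ≫ tgtMap _ _ = 𝟙 (a ⟶[V] a')
  /-- The composition `V`-functor on hom-objects. -/
  vcompMap {a b d a' b' d' : Obj} (i : Ver a b) (j : Ver b d) (i' : Ver a' b') (j' : Ver b' d') :
    toInternalGraph.pairHom i j i' j' ⟶
      (toInternalGraph.ar (vcomp i j) ⟶[V] toInternalGraph.ar (vcomp i' j'))
  vcompMap_id {a b d : Obj} (i : Ver a b) (j : Ver b d) :
    toInternalGraph.pairId i j ≫ vcompMap i j i j = eId V (toInternalGraph.ar (vcomp i j))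
  vcompMap_comp {a b d a' b' d' a'' b'' d'' : Obj} (i : Ver a b) (j : Ver b d)
    (i' : Ver a' b') (j' : Ver b' d') (i'' : Ver a'' b'') (j'' : Ver b'' d'') :
    toInternalGraph.pairComp i j i' j' i'' j'' ≫ vcompMap i j i'' j'' =
      (vcompMap i j i' j' ⊗ₘ vcompMap i' j' i'' j'') ≫ eComp V _ _ _
  vcompMap_src {a b d a' b' d' : Obj} (i : Ver a b) (j : Ver b d) (i' : Ver a' b')
    (j' : Ver b' d') : vcompMap i j i' j' ≫ srcMap _ _ =
      toInternalGraph.pairFst i j i' j' ≫ srcMap _ _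
  vcompMap_tgt {a b d a' b' d' : Obj} (i : Ver a b) (j : Ver b d) (i' : Ver a' b')
    (j' : Ver b' d') : vcompMap i j i' j' ≫ tgtMap _ _ =
      toInternalGraph.pairSnd i j i' j' ≫ tgtMap _ _
  vidMap_vcompMap {a b a' b' : Obj} (i : Ver a b) (i' : Ver a' b') :
    toInternalGraph.pairLift (srcMap (toInternalGraph.ar i) (toInternalGraph.ar i') ≫ vidMap a a')
        (𝟙 _) (by rw [Category.assoc, vidMap_tgt, Category.comp_id, Category.id_comp]) ≫
      vcompMap (vid a) i (vid a') i' = eqToHom (by rw [vid_vcomp, vid_vcomp])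
  vcompMap_vidMap {a b a' b' : Obj} (i : Ver a b) (i' : Ver a' b') :
    toInternalGraph.pairLift (𝟙 _)
        (tgtMap (toInternalGraph.ar i) (toInternalGraph.ar i') ≫ vidMap b b')
        (by rw [Category.assoc, vidMap_src, Category.comp_id, Category.id_comp]) ≫
      vcompMap i (vid b) i' (vid b') = eqToHom (by rw [vcomp_vid, vcomp_vid])
  vcompMap_assoc {a b d e a' b' d' e' : Obj} (i : Ver a b) (j : Ver b d) (k : Ver d e)
    (i' : Ver a' b') (j' : Ver b' d') (k' : Ver d' e') {T : V}
    (r : T ⟶ (toInternalGraph.ar i ⟶[V] toInternalGraph.ar i'))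
    (s : T ⟶ (toInternalGraph.ar j ⟶[V] toInternalGraph.ar j'))
    (t : T ⟶ (toInternalGraph.ar k ⟶[V] toInternalGraph.ar k'))
    (hrs : r ≫ tgtMap _ _ = s ≫ srcMap _ _) (hst : s ≫ tgtMap _ _ = t ≫ srcMap _ _) :
    toInternalGraph.pairLift (toInternalGraph.pairLift r s hrs ≫ vcompMap i j i' j') t
        (by
          rw [Category.assoc, vcompMap_tgt, ← hst, ← Category.assoc]
          exact congrArg (· ≫ _) (pullback.lift_snd _ _ _)) ≫
      vcompMap (vcomp i j) k (vcomp i' j') k' ≫ eqToHom (by rw [vcomp_assoc, vcomp_assoc]) =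
    toInternalGraph.pairLift r (toInternalGraph.pairLift s t hst ≫ vcompMap j k j' k')
        (by
          rw [Category.assoc, vcompMap_src, hrs, ← Category.assoc]
          exact congrArg (· ≫ _) (pullback.lift_fst _ _ _).symm) ≫
      vcompMap i (vcomp j k) i' (vcomp j' k')

variable {V}

/-- An internal functor from `J` to the internal category of squares of `C`. Its `V`-functor on
arrows sends a vertical arrow to `arrMap i`; on hom-objects it is determined by `srcMap`,
`tgtMap` and `objFunctor`. -/
structure InternalCat.ToSq (J : InternalCat.{v₁, u₁, w} V) (C : Type u₂) [Category.{v₂} C]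
    [EnrichedOrdinaryCategory V C] where
  /-- The `V`-functor on objects. -/
  objFunctor : EnrichedFunctor V J.Obj C
  /-- The morphism of `C` that is the value at a vertical arrow. -/
  arrMap {a b : J.Obj} (i : J.Ver a b) : objFunctor.obj a ⟶ objFunctor.obj b
  natural : IsVNatural V (J.srcFunctor.comp V objFunctor) (J.tgtFunctor.comp V objFunctor)
    fun x => arrMap x.arr
  arrMap_vid (a : J.Obj) : arrMap (J.vid a) = 𝟙 _
  arrMap_vcomp {a b d : J.Obj} (i : J.Ver a b) (j : J.Ver b d) :
    arrMap (J.vcomp i j) = arrMap i ≫ arrMap j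

namespace InternalCat.ToSq

variable {J : InternalCat.{v₁, u₁, w} V} {C : Type u₂} [Category.{v₂} C]
    [EnrichedOrdinaryCategory V C] (U : J.ToSq C)

/-- The `V`-functor `J_1 ⟶ C^2` of an internal functor to squares. -/
noncomputable def arrFunctor : EnrichedFunctor V J.Arr (Arrow C) :=
  toArrow (J.srcFunctor.comp V U.objFunctor) (J.tgtFunctor.comp V U.objFunctor)
    (fun x => U.arrMap x.arr) U.natural

/-- The value of `U` at a vertical arrow, as an object of `C^2`. -/
abbrev ar {a b : J.Obj} (i : J.Ver a b) : Arrow C := Arrow.mk (U.arrMap i)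

end InternalCat.ToSq

end Internal

/-! ### Structured liftings against an internal category -/

section Pullback

variable (V : Type u₁) [Category.{v₁} V] [MonoidalCategory V] [HasPullbacks V]
variable {C : Type u₂} [Category.{v₂} C] [EnrichedOrdinaryCategory V C]
variable {A B D : C} (g : A ⟶ B) (h : B ⟶ D) (k : A ⟶ D) (hk : g ≫ h = k) (f : Arrow C)

/-- For `k = h ∘ g`, the morphism `C^2(h, f) ⟶ C^2(k, f)`, `(s, t) ↦ (s ∘ g, t)`. -/
noncomputable def arrowPre : arrowHom V (Arrow.mk h) f ⟶ arrowHom V (Arrow.mk k) f :=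
  arrowLift V (arrowFst V (Arrow.mk h) f ≫ eHomWhiskerRight V g f.left)
    (arrowSnd V (Arrow.mk h) f) (by
      subst hk
      have h1 := arrow_condition V (Arrow.mk h) f
      have h2 := eHom_whisker_exchange V g f.hom
      dsimp only [Arrow.mk_left, Arrow.mk_right, Arrow.mk_hom] at h1 ⊢
      rw [Category.assoc, ← h2, reassoc_of% h1, ← eHomWhiskerRight_comp])

/-- For `k = h ∘ g`, the morphism `C^2(k, f) ⟶ C^2(g, f)`, `(s, t) ↦ (s, t ∘ h)`. -/
noncomputable def arrowSub : arrowHom V (Arrow.mk k) f ⟶ arrowHom V (Arrow.mk g) f :=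
  arrowLift V (arrowFst V (Arrow.mk k) f)
    (arrowSnd V (Arrow.mk k) f ≫ eHomWhiskerRight V h f.right) (by
      subst hk
      have h1 := arrow_condition V (Arrow.mk (g ≫ h)) f
      dsimp only [Arrow.mk_left, Arrow.mk_right, Arrow.mk_hom] at h1 ⊢
      rw [Category.assoc, ← eHomWhiskerRight_comp, h1])

lemma arrowPre_sub : arrowPre V g h k hk f ≫ arrowSub V g h k hk f =
    arrowFst V (Arrow.mk h) f ≫ arrowDiag V (Arrow.mk g) f := by
  apply arrowHom_ext
  · rw [Category.assoc, arrowSub, arrowLift_fst, arrowPre, arrowLift_fst, Category.assoc,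
      arrowDiag_fst]
    rfl
  · rw [Category.assoc, arrowSub, arrowLift_snd, arrowPre, Category.assoc, arrowDiag_snd,
      ← Category.assoc, arrowLift_snd]
    exact (arrow_condition V (Arrow.mk h) f).symm

lemma arrowDiag_pre : arrowDiag V (Arrow.mk h) f ≫ arrowPre V g h k hk f =
    arrowDiag V (Arrow.mk k) f := by
  subst hk
  apply arrowHom_ext
  · rw [Category.assoc, arrowPre, arrowLift_fst, arrowDiag_fst, ← Category.assoc, arrowDiag_fst]
    exact (eHomWhiskerRight_comp V g h f.left).symm
  · rw [Category.assoc, arrowPre, arrowLift_snd, arrowDiag_snd, arrowDiag_snd]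
    rfl

end Pullback

section Pitchfork

open scoped MonoidalClosed

variable {V : Type u₁} [Category.{v₁} V] [MonoidalCategory V] [MonoidalClosed V]
  [HasPullbacks V]
variable {C : Type u₂} [Category.{v₂} C] [EnrichedOrdinaryCategory V C]

section Pulled

variable (𝓜 : AWFS V V) {A B D : C} (g : A ⟶ B) (h : B ⟶ D) (k : A ⟶ D) (hk : g ≫ h = k)
  (f : Arrow C) (p : 𝓜.K.obj (Arrow.mk (arrowDiag V (Arrow.mk g) f)) ⟶ (B ⟶[V] f.left))

/-- The algebra structure on `C^2(h, f) ⟶ C^2(k, f)`, as the pullback of the algebra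
`C(cod g, dom f) ⟶ C^2(g, f)`. -/
noncomputable def pulledStr (hp : 𝓜.IsAlg (Arrow.mk (arrowDiag V (Arrow.mk g) f)) p) :
    𝓜.K.obj (Arrow.mk (arrowPre V g h k hk f)) ⟶
    arrowHom V (Arrow.mk h) f :=
  arrowLift V
    (𝓜.Kmap (Arrow.homMk (f := Arrow.mk (arrowPre V g h k hk f))
      (g := Arrow.mk (arrowDiag V (Arrow.mk g) f)) (arrowFst V (Arrow.mk h) f)
      (arrowSub V g h k hk f) (arrowPre_sub V g h k hk f).symm) ≫ p)
    (𝓜.rho (Arrow.mk (arrowPre V g h k hk f)) ≫ arrowSnd V (Arrow.mk k) f) (by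
      have h1 : p ≫ eHomWhiskerLeft V B f.hom =
          𝓜.rho (Arrow.mk (arrowDiag V (Arrow.mk g) f)) ≫ arrowSnd V (Arrow.mk g) f := by
        rw [← hp.comp_hom]
        exact ((Category.assoc _ _ _).trans (congrArg _ (arrowDiag_snd V (Arrow.mk g) f))).symm
      refine (Category.assoc _ _ _).trans ((congrArg _ h1).trans ?_)
      refine (Category.assoc _ _ _).symm.trans ?_
      refine (congrArg (· ≫ arrowSnd V (Arrow.mk g) f) (𝓜.Kmap_rho
        (Arrow.homMk (f := Arrow.mk (arrowPre V g h k hk f))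
          (g := Arrow.mk (arrowDiag V (Arrow.mk g) f)) (arrowFst V (Arrow.mk h) f)
          (arrowSub V g h k hk f) (arrowPre_sub V g h k hk f).symm)).symm).trans ?_
      refine (Category.assoc _ _ _).trans (Eq.trans ?_ (Category.assoc _ _ _).symm)
      exact congrArg _ (arrowLift_snd V _ _ _))

lemma lam_pulledStr (hp : 𝓜.IsAlg (Arrow.mk (arrowDiag V (Arrow.mk g) f)) p) :
    𝓜.lam (Arrow.mk (arrowPre V g h k hk f)) ≫
    pulledStr 𝓜 g h k hk f p hp = 𝟙 _ := by
  apply arrowHom_ext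
  · rw [Category.assoc, pulledStr, arrowLift_fst, Category.id_comp]
    refine (Category.assoc _ _ _).symm.trans ?_
    refine (congrArg (· ≫ p) (𝓜.lam_Kmap _)).trans ?_
    refine (Category.assoc _ _ _).trans ?_
    exact (congrArg _ hp.unit).trans (Category.comp_id _)
  · rw [Category.assoc, pulledStr, arrowLift_snd, Category.id_comp]
    refine (Category.assoc _ _ _).symm.trans ?_
    refine (congrArg (· ≫ _) (𝓜.lam_rho _)).trans ?_
    exact arrowLift_snd V _ _ _

end Pulled

variable [BraidedCategory V]
variable {J : InternalCat.{v₁, u₁, w} V} (𝓜 : AWFS V V) (U : J.ToSq C)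

/-- The arrow `C(cod U i, dom f) ⟶ C^2(U i, f)` of `V`. -/
noncomputable abbrev wArr (x : J.Arr) (f : Arrow C) : Arrow V :=
  Arrow.mk (arrowDiag V (U.arrFunctor.obj x) f)

/-- The `V`-functor `f ↦ K(C(cod U i, dom f) ⟶ C^2(U i, f))`. -/
noncomputable def srcStr (x : J.Arr) : EnrichedFunctor V (Arrow C) V :=
  (diagCov V (U.arrFunctor.obj x)).comp V 𝓜.K

/-- The `V`-functor `f ↦ C(cod U i, dom f)`. -/
noncomputable def tgtStr (x : J.Arr) : EnrichedFunctor V (Arrow C) V :=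
  (domFunctor V C).comp V (covHom (U.arrFunctor.obj x).right)

/-- The `V`-functor `i ↦ K(C(cod U i, dom f) ⟶ C^2(U i, f))`, contravariant in `i`. -/
noncomputable def srcPresheaf (f : Arrow C) : EnrichedFunctor V J.Arrᵒᵖ V :=
  ((opFunctor U.arrFunctor).comp V (diagContra V f)).comp V 𝓜.K

/-- The `V`-functor `i ↦ C(cod U i, dom f)`, contravariant in `i`. -/
noncomputable def tgtPresheaf (f : Arrow C) : EnrichedFunctor V J.Arrᵒᵖ V :=
  ((opFunctor U.arrFunctor).comp V (opFunctor (codFunctor V C))).comp V (contraHom f.left)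

/-- The conditions on a family of structures `p_i` on the arrows
`C(cod U i, dom f) ⟶ C^2(U i, f)`: each is an algebra for the monad of the AWFS, the family is
`V`-natural in `i`, and the structure at a vertical composite `j • i` is the composite of the
structure at `j` and of the pullback of the structure at `i`. -/
structure IsPitchfork (x : Inserter (srcStr 𝓜 U) (tgtStr (V := V) U)) : Prop where
  alg (i : J.Arr) : 𝓜.IsAlg (wArr U i x.obj) (x.str i)
  natural : IsVNatural V (srcPresheaf 𝓜 U x.obj) (tgtPresheaf U x.obj) fun i => x.str i.unop
  comp {a b d : J.Obj} (i : J.Ver a b) (j : J.Ver b d) :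
    x.str (J.ar (J.vcomp i j)) = 𝓜.compStr (arrowDiag V (U.ar j) x.obj)
      (arrowPre V (U.arrMap i) (U.arrMap j) (U.arrMap (J.vcomp i j)) (U.arrMap_vcomp i j).symm
        x.obj)
      (arrowDiag V (U.ar (J.vcomp i j)) x.obj) (arrowDiag_pre V _ _ _ _ _) (x.str (J.ar j))
      (pulledStr 𝓜 _ _ _ _ _ (x.str (J.ar i)) (alg (J.ar i)))
      (lam_pulledStr 𝓜 _ _ _ _ _ (x.str (J.ar i)) (alg (J.ar i)))

/-- The category of arrows of `C` equipped with structured liftings against `U`. As a full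
subcategory of an inserter it is a `V`-category: its hom-object from `(f, p)` to `(g, q)` is the
equaliser of `C^2(f, g) ⇉ ∏ i, [K(C(cod U i, dom f) ⟶ C^2(U i, f)), C(cod U i, dom g)]`. -/
abbrev Pitchfork := ObjectProperty.FullSubcategory (IsPitchfork 𝓜 U)

/-- The forgetful functor to `C^2`. -/
noncomputable abbrev pitchforkForget : Pitchfork 𝓜 U ⥤ Arrow C :=
  ObjectProperty.ι (IsPitchfork 𝓜 U) ⋙ Inserter.forget _ _

end Pitchfork

/-! ### Colimits in `V`-categories -/

section Colimits

variable (V : Type u₁) [Category.{v₁} V] [MonoidalCategory V]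

/-- `c` is a colimit in the `V`-enriched sense: each `C(-, Y)` sends it to a limit in `V`. -/
def IsConicalColimit {C : Type u₂} [Category.{v₂} C] [EnrichedOrdinaryCategory V C]
    {𝒟 : Type u₃} [Category.{v₃} 𝒟] {F : 𝒟 ⥤ C} (c : Cocone F) : Prop :=
  ∀ Y : C, Nonempty (IsLimit (((eHomFunctor V C).flip.obj Y).mapCone c.op))

/-- `G` creates the colimit of `D`: each colimit cocone under `D ⋙ G` is the image of a unique
cocone under `D`, and this one is a colimit in the `V`-enriched sense. -/
def CreatesConicalColimit {A : Type u₂} [Category.{v₂} A] [EnrichedOrdinaryCategory V A]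
    {B : Type u₃} [Category.{v₃} B] (G : A ⥤ B) {𝒟 : Type w} [SmallCategory 𝒟] (D : 𝒟 ⥤ A) :
    Prop :=
  ∀ c : Cocone (D ⋙ G), Nonempty (IsColimit c) →
    (∃! c' : Cocone D, G.mapCocone c' = c) ∧
      ∀ c' : Cocone D, G.mapCocone c' = c → IsConicalColimit V c'

/-- `C` is cocomplete as a `V`-category: it has small colimits in the `V`-enriched sense, and
tensors `v ⊗ X`, which are characterised by `C(v ⊗ X, Y) ≅ [v, C(X, Y)]`. -/
structure IsCocomplete [MonoidalClosed V] (C : Type u₂) [Category.{v₂} C]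
    [EnrichedOrdinaryCategory V C] : Prop where
  exists_conicalColimit {𝒟 : Type w} [SmallCategory 𝒟] (F : 𝒟 ⥤ C) :
    ∃ c : Cocone F, IsConicalColimit V c
  exists_tensor (v : V) (X : C) : ∃ (T : C) (η : v ⟶ (X ⟶[V] T)), ∀ Y : C,
    IsIso (MonoidalClosed.curry (η ▷ (T ⟶[V] Y) ≫ eComp V X T Y))

end Colimits

/-! ### Locally ranked categories -/

section Ranked

variable {C : Type u₂} [Category.{v₂} C]

/-- An orthogonal factorisation system: a weak one with unique diagonal fillers. -/
structure IsOFS (E M : MorphismProperty C) : Prop where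
  isWFS : MorphismProperty.IsWeakFactorizationSystem E M
  unique_lift {A B X Y : C} {f : A ⟶ X} {i : A ⟶ B} {p : X ⟶ Y} {g : B ⟶ Y}
    (sq : CommSq f i p g) : E i → M p → Subsingleton sq.LiftStruct

/-- `A` has rank at most `κ` with respect to `M`: `C(A, -)` preserves the colimits of the small
`κ`-filtered diagrams that have a cocone with components in `M`. -/
def HasRankLE (M : MorphismProperty C) (A : C) (κ : Cardinal.{w}) [Fact κ.IsRegular] : Prop :=
  ∀ (𝒟 : Type w) [SmallCategory 𝒟] [IsCardinalFiltered 𝒟 κ] (X : 𝒟 ⥤ C) (m : Cocone X),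
    (∀ d, M (m.ι.app d)) → PreservesColimit X (coyoneda.obj (Opposite.op A))

/-- `C` is locally ranked with respect to the proper orthogonal factorisation system `(E, M)`:
it is cocomplete, it has only a small set of `E`-quotients of each object, and each object has a
rank. -/
structure IsLocallyRanked (E M : MorphismProperty C) : Prop where
  hasColimits : HasColimitsOfSize.{w, w} C
  isOFS : IsOFS E M
  epi {X Y : C} (e : X ⟶ Y) : E e → Epi e
  mono {X Y : C} (m : X ⟶ Y) : M m → Mono m
  cowellpowered (X : C) : ∃ (I : Type w) (Q : I → C) (q : ∀ i, X ⟶ Q i), (∀ i, E (q i)) ∧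
    ∀ (Y : C) (e : X ⟶ Y), E e → ∃ (i : I) (s : Q i ≅ Y), q i ≫ s.hom = e
  exists_rank (A : C) : ∃ (κ : Cardinal.{w}) (_ : Fact κ.IsRegular), HasRankLE M A κ

end Ranked

/-! ### Bases of enrichment -/

section Base

/-- A full sub-2-category of `Cat` suitable as a base of enrichment: it is closed under limits
and exponentials in `Cat`, it has colimits, and it contains the arrow category. -/
class IsBase (P : ObjectProperty Cat.{w, w}) : Prop where
  closedUnderLimits (I : Type w) [SmallCategory I] : P.IsClosedUnderLimitsOfShape I
  prop_exponential (X Y : Cat.{w, w}) : P X → P Y → P ((ihom X).obj Y)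
  hasColimits : HasColimitsOfSize.{w, w} P.FullSubcategory
  prop_two : P (Cat.of (ULift.{w} (Fin 2)))

variable (P : ObjectProperty Cat.{w, w}) [IsBase P]

instance isBase_hasLimits : HasLimits P.FullSubcategory := by
  refine ⟨fun I _ => ?_⟩
  have := IsBase.closedUnderLimits (P := P) I
  infer_instance

instance isBase_isMonoidal : P.IsMonoidal where
  prop_unit := by
    have := IsBase.closedUnderLimits (P := P) (Discrete PEmpty.{w + 1})
    have : P.IsClosedUnderLimitsOfShape (Discrete PEmpty.{1}) :=
      ObjectProperty.IsClosedUnderLimitsOfShape.of_equivalence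
        (Discrete.equivalence (Equiv.equivOfIsEmpty _ _) : Discrete PEmpty.{w + 1} ≌ _)
    exact P.prop_of_isLimit (CartesianMonoidalCategory.isTerminalTensorUnit (C := Cat.{w, w}))
      (fun j => j.as.elim)
  prop_tensor X Y hX hY := by
    have := IsBase.closedUnderLimits (P := P) (Discrete (ULift.{w} WalkingPair))
    have : P.IsClosedUnderLimitsOfShape (Discrete WalkingPair) :=
      ObjectProperty.IsClosedUnderLimitsOfShape.of_equivalence
        (Discrete.equivalence Equiv.ulift : Discrete (ULift.{w} WalkingPair) ≌ _)
    refine P.prop_of_isLimit (CartesianMonoidalCategory.tensorProductIsBinaryProduct X Y) ?_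
    rintro ⟨_ | _⟩
    · exact hX
    · exact hY

instance isBase_isMonoidalClosed : P.IsMonoidalClosed where
  prop_ihom := IsBase.prop_exponential

end Base

end EnrichedAWFS

open EnrichedAWFS
open scoped MonoidalClosed

universe u w

/-!
If `κ` bounds the ranks of the tensors of `dom (U i)` and `cod (U i)` with objects `G n` of `V`
whose representables jointly reflect filtered colimits, then `C(dom (U i), -)` and `C(cod (U i), -)`
preserve `κ`-filtered colimits of `M`-subobjects. Finite limits commute with such colimits, so
`C^2(U i, -)` preserves them too, and `W_i` sends them to componentwise colimits of arrows of `V`;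
if `K` preserves `κ`-filtered colimits, these are preserved by `K` and by `K R`.

Hence the structure maps at the stages of a diagram induce a unique structure map at the colimit.
The algebra axioms, naturality in `i`, compatibility with vertical composition and the universal
property are equations between maps out of `W_i`, `K W_i` and `K R W_i`, and can be tested on the
jointly epimorphic colimit cocones; as `V` is closed, these are jointly epimorphic in the enriched
sense as well.

A base of enrichment in `Cat` is closed under retracts and contains `0 ⟶ 1`, hence also `0` and
`0 ⟶ 1 ⟶ 2`. These three test objects suffice, since the `2`-truncated nerve is fully faithful.
-/

universe v₁ u₁ v₂ u₂ v₃ u₃ v₄ u₄ w'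

namespace EnrichedAWFS

open Opposite

section Underlying

variable {V : Type u₁} [Category.{v₁} V] [MonoidalCategory V]
variable {D : Type u₂} [Category.{v₂} D] [EnrichedOrdinaryCategory V D]
variable {C : Type u₃} [Category.{v₃} C] [EnrichedOrdinaryCategory V C]
variable {E : Type u₄} [Category.{v₄} E] [EnrichedOrdinaryCategory V E]

lemma mapHom_functor_comp (F : EnrichedFunctor V D C) (G : EnrichedFunctor V C E) {X Y : D}
    (f : X ⟶ Y) : mapHom (F.comp V G) f = mapHom G (mapHom F f) := by
  have h : eHomEquiv V (mapHom G (mapHom F f)) = eHomEquiv V f ≫ F.map X Y ≫ G.map _ _ := by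
    rw [eHomEquiv_mapHom, eHomEquiv_mapHom, Category.assoc]
  exact (eHomEquiv V).injective ((eHomEquiv_mapHom (F.comp V G) f).trans h.symm)

lemma map_eHomWhiskerLeft (F : EnrichedFunctor V D C) (X : D) {Y Y' : D} (s : Y ⟶ Y') :
    F.map X Y ≫ eHomWhiskerLeft V (F.obj X) (mapHom F s) =
      eHomWhiskerLeft V X s ≫ F.map X Y' := by
  simp only [eHomWhiskerLeft, Category.assoc, EnrichedFunctor.map_comp, eHomEquiv_mapHom]
  rw [rightUnitor_inv_naturality_assoc, MonoidalCategory.tensorHom_def]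
  simp only [MonoidalCategory.whiskerLeft_comp, Category.assoc]
  rw [whisker_exchange_assoc]

lemma map_eHomWhiskerRight (F : EnrichedFunctor V D C) {X X' : D} (s : X ⟶ X') (Y : D) :
    F.map X' Y ≫ eHomWhiskerRight V (mapHom F s) (F.obj Y) =
      eHomWhiskerRight V s Y ≫ F.map X Y := by
  simp only [eHomWhiskerRight, Category.assoc, EnrichedFunctor.map_comp, eHomEquiv_mapHom]
  rw [leftUnitor_inv_naturality_assoc, tensorHom_def']
  simp only [comp_whiskerRight, Category.assoc]
  rw [whisker_exchange_assoc]

end Underlying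

section Naturality

variable {V : Type u₁} [Category.{v₁} V] [MonoidalCategory V]
variable {D : Type u₂} [EnrichedCategory V D]
variable {C : Type u₃} [Category.{v₃} C] [EnrichedOrdinaryCategory V C]
variable {F G : EnrichedFunctor V D C} {τ τ' : ∀ d, F.obj d ⟶ G.obj d}

lemma IsVNatural.congr (h : IsVNatural V F G τ) (e : ∀ d, τ d = τ' d) : IsVNatural V F G τ' :=
  (funext e : τ = τ') ▸ h

lemma IsVNatural.functor_comp {B : Type u₄} [EnrichedCategory V B] (h : IsVNatural V F G τ)
    (H : EnrichedFunctor V B D) :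
    IsVNatural V (H.comp V F) (H.comp V G) fun b => τ (H.obj b) := fun _ _ =>
  (Category.assoc _ _ _).trans ((congrArg _ (h _ _)).trans (Category.assoc _ _ _).symm)

lemma IsVNatural.comp_functor {E : Type u₄} [Category.{v₄} E] [EnrichedOrdinaryCategory V E]
    (h : IsVNatural V F G τ) (H : EnrichedFunctor V C E) :
    IsVNatural V (F.comp V H) (G.comp V H) fun d => mapHom H (τ d) := fun d d' =>
  calc (F.map d d' ≫ H.map _ _) ≫ eHomWhiskerLeft V (H.obj (F.obj d)) (mapHom H (τ d'))
    _ = F.map d d' ≫ eHomWhiskerLeft V (F.obj d) (τ d') ≫ H.map _ _ := by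
      rw [Category.assoc, map_eHomWhiskerLeft]
    _ = G.map d d' ≫ eHomWhiskerRight V (τ d) (G.obj d') ≫ H.map _ _ := by
      rw [reassoc_of% h d d']
    _ = (G.map d d' ≫ H.map _ _) ≫ eHomWhiskerRight V (mapHom H (τ d)) (H.obj (G.obj d')) := by
      rw [Category.assoc, map_eHomWhiskerRight]

end Naturality

section ArrowFunctors

variable {V : Type u₁} [Category.{v₁} V] [MonoidalCategory V] [HasPullbacks V]
variable {C : Type u₃} [Category.{v₃} C] [EnrichedOrdinaryCategory V C]

lemma mapHom_domFunctor {f g : Arrow C} (s : f ⟶ g) : mapHom (domFunctor V C) s = s.left :=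
  (eHomEquiv V).injective ((eHomEquiv_mapHom _ _).trans (arrowElt_fst V s))

lemma mapHom_codFunctor {f g : Arrow C} (s : f ⟶ g) : mapHom (codFunctor V C) s = s.right :=
  (eHomEquiv V).injective ((eHomEquiv_mapHom _ _).trans (arrowElt_snd V s))

lemma eHomWhiskerLeft_arrowFst (g : Arrow C) {f f' : Arrow C} (s : f ⟶ f') :
    eHomWhiskerLeft V g s ≫ arrowFst V g f' =
      arrowFst V g f ≫ eHomWhiskerLeft V g.left s.left := by
  rw [← mapHom_domFunctor (V := V) s]
  exact (map_eHomWhiskerLeft (domFunctor V C) g s).symm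

lemma eHomWhiskerLeft_arrowSnd (g : Arrow C) {f f' : Arrow C} (s : f ⟶ f') :
    eHomWhiskerLeft V g s ≫ arrowSnd V g f' =
      arrowSnd V g f ≫ eHomWhiskerLeft V g.right s.right := by
  rw [← mapHom_codFunctor (V := V) s]
  exact (map_eHomWhiskerLeft (codFunctor V C) g s).symm

lemma eHomWhiskerRight_arrowFst {g g' : Arrow C} (s : g ⟶ g') (f : Arrow C) :
    eHomWhiskerRight V s f ≫ arrowFst V g f =
      arrowFst V g' f ≫ eHomWhiskerRight V s.left f.left := by
  rw [← mapHom_domFunctor (V := V) s]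
  exact (map_eHomWhiskerRight (domFunctor V C) s f).symm

lemma eHomWhiskerRight_arrowSnd {g g' : Arrow C} (s : g ⟶ g') (f : Arrow C) :
    eHomWhiskerRight V s f ≫ arrowSnd V g f =
      arrowSnd V g' f ≫ eHomWhiskerRight V s.right f.right := by
  rw [← mapHom_codFunctor (V := V) s]
  exact (map_eHomWhiskerRight (codFunctor V C) s f).symm

lemma comp_eHomWhisker_eq_of_components {T : V} {f g f' g' : Arrow C} {s : f ⟶ f'} {t : g ⟶ g'}
    {a : T ⟶ (f ⟶[V] g)} {b : T ⟶ (f' ⟶[V] g')}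
    (hl : (a ≫ arrowFst V f g) ≫ eHomWhiskerLeft V f.left t.left =
      (b ≫ arrowFst V f' g') ≫ eHomWhiskerRight V s.left g'.left)
    (hr : (a ≫ arrowSnd V f g) ≫ eHomWhiskerLeft V f.right t.right =
      (b ≫ arrowSnd V f' g') ≫ eHomWhiskerRight V s.right g'.right) :
    a ≫ eHomWhiskerLeft V f t = b ≫ eHomWhiskerRight V s g' := by
  refine arrowHom_ext V ?_ ?_
  · rw [Category.assoc, Category.assoc, eHomWhiskerLeft_arrowFst, eHomWhiskerRight_arrowFst]
    simpa only [Category.assoc] using hl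
  · rw [Category.assoc, Category.assoc, eHomWhiskerLeft_arrowSnd, eHomWhiskerRight_arrowSnd]
    simpa only [Category.assoc] using hr

section

variable {D : Type u₂} [EnrichedCategory V D] (F G : EnrichedFunctor V D C)
  (τ : ∀ d, F.obj d ⟶ G.obj d) (h : IsVNatural V F G τ)

lemma toArrow_map_arrowFst (d d' : D) :
    (toArrow F G τ h).map d d' ≫ arrowFst V (Arrow.mk (τ d)) (Arrow.mk (τ d')) = F.map d d' :=
  arrowLift_fst V _ _ _

lemma toArrow_map_arrowSnd (d d' : D) :
    (toArrow F G τ h).map d d' ≫ arrowSnd V (Arrow.mk (τ d)) (Arrow.mk (τ d')) = G.map d d' :=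
  arrowLift_snd V _ _ _

end

section

variable {D : Type u₂} [Category.{v₂} D] [EnrichedOrdinaryCategory V D]
  (F G : EnrichedFunctor V D C) (τ : ∀ d, F.obj d ⟶ G.obj d) (h : IsVNatural V F G τ)

lemma mapHom_toArrow_left {d d' : D} (s : d ⟶ d') :
    (mapHom (toArrow F G τ h) s).left = mapHom F s := by
  have hs : eHomEquiv V (mapHom F s) =
      (eHomEquiv V s ≫ (toArrow F G τ h).map d d') ≫ arrowFst V _ _ := by
    rw [eHomEquiv_mapHom, Category.assoc, ← toArrow_map_arrowFst F G τ h]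
    rfl
  rw [← eHomEquiv_mapHom] at hs
  exact (eHomEquiv V).injective ((arrowElt_fst V _).symm.trans hs.symm)

lemma mapHom_toArrow_right {d d' : D} (s : d ⟶ d') :
    (mapHom (toArrow F G τ h) s).right = mapHom G s := by
  have hs : eHomEquiv V (mapHom G s) =
      (eHomEquiv V s ≫ (toArrow F G τ h).map d d') ≫ arrowSnd V _ _ := by
    rw [eHomEquiv_mapHom, Category.assoc, ← toArrow_map_arrowSnd F G τ h]
    rfl
  rw [← eHomEquiv_mapHom] at hs
  exact (eHomEquiv V).injective ((arrowElt_snd V _).symm.trans hs.symm)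

end

lemma IsVNatural.toArrow {D : Type u₂} [EnrichedCategory V D] {F G F' G' : EnrichedFunctor V D C}
    {τ : ∀ d, F.obj d ⟶ G.obj d} {τ' : ∀ d, F'.obj d ⟶ G'.obj d} (h : IsVNatural V F G τ)
    (h' : IsVNatural V F' G' τ') (s : ∀ d, Arrow.mk (τ d) ⟶ Arrow.mk (τ' d))
    (hl : IsVNatural V F F' fun d => (s d).left) (hr : IsVNatural V G G' fun d => (s d).right) :
    IsVNatural V (toArrow F G τ h) (toArrow F' G' τ' h') s := fun d d' =>
  comp_eHomWhisker_eq_of_components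
    (a := (EnrichedAWFS.toArrow F G τ h).map d d')
    (b := (EnrichedAWFS.toArrow F' G' τ' h').map d d')
    ((congrArg (· ≫ _) (toArrow_map_arrowFst F G τ h d d')).trans
      ((hl d d').trans (congrArg (· ≫ _) (toArrow_map_arrowFst F' G' τ' h' d d').symm)))
    ((congrArg (· ≫ _) (toArrow_map_arrowSnd F G τ h d d')).trans
      ((hr d d').trans (congrArg (· ≫ _) (toArrow_map_arrowSnd F' G' τ' h' d d').symm)))

end ArrowFunctors

section JointlyEpi

/-- A family of morphisms with a common codomain `Y` is jointly epimorphic when morphisms out of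
`Y` are determined by their composites with its members. -/
def JointlyEpi {C : Type u₁} [Category.{v₁} C] {I : Type u₂} {X : I → C} {Y : C}
    (s : ∀ d, X d ⟶ Y) : Prop :=
  ∀ ⦃Z : C⦄ ⦃a b : Y ⟶ Z⦄, (∀ d, s d ≫ a = s d ≫ b) → a = b

lemma jointlyEpi_of_isColimit {C : Type u₁} [Category.{v₁} C] {𝒟 : Type u₂} [Category.{v₂} 𝒟]
    {F : 𝒟 ⥤ C} {c : Cocone F} (hc : IsColimit c) : JointlyEpi c.ι.app :=
  fun _ _ _ h => hc.hom_ext h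

end JointlyEpi

section Representables

variable {V : Type u₁} [Category.{v₁} V] [MonoidalCategory V] [MonoidalClosed V]
variable {C : Type u₃} [Category.{v₃} C] [EnrichedOrdinaryCategory V C]

lemma mapHom_covHom (A : C) {X Y : C} (s : X ⟶ Y) :
    mapHom (covHom (V := V) A) s = eHomWhiskerLeft V A s := by
  refine (eHomEquiv V).injective ((eHomEquiv_mapHom (covHom (V := V) A) s).trans ?_)
  refine Eq.trans ?_ (MonoidalClosed.enrichedOrdinaryCategorySelf_homEquiv V _).symm
  refine (MonoidalClosed.curry_natural_left _ _).symm.trans ?_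
  exact congrArg MonoidalClosed.curry
    (Iso.hom_inv_id_assoc (ρ_ (A ⟶[V] X)) (_ ◁ eHomEquiv V s ≫ eComp V A X Y)).symm

section

variable [HasPullbacks V]

lemma mapHom_diagCov_left (g : Arrow C) {f f' : Arrow C} (s : f ⟶ f') :
    (mapHom (diagCov V g) s).left = eHomWhiskerLeft V g.right s.left := by
  refine (mapHom_toArrow_left _ _ _ _ s).trans ?_
  rw [mapHom_functor_comp, mapHom_covHom, mapHom_domFunctor]
  rfl

lemma mapHom_diagCov_right (g : Arrow C) {f f' : Arrow C} (s : f ⟶ f') :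
    (mapHom (diagCov V g) s).right = eHomWhiskerLeft V g s :=
  (mapHom_toArrow_right _ _ _ _ s).trans (mapHom_covHom g s)

end

variable [BraidedCategory V]

lemma isVNatural_contraHom {X X' : C} (s : X ⟶ X') :
    IsVNatural V (contraHom (V := V) X) (contraHom X') fun A => eHomWhiskerLeft V A.unop s :=
  isVNatural_of_uncurry _ _ _ fun A B => by
    refine (congrArg (· ≫ _) (MonoidalClosed.uncurry_curry _)).trans ?_
    refine Eq.trans ?_ (congrArg _ (MonoidalClosed.uncurry_curry _)).symm
    refine (Category.assoc _ _ _).trans ((congrArg _ (eComp_eHomWhiskerLeft V _ _ s)).trans ?_)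
    exact (BraidedCategory.braiding_naturality_left_assoc _ _ _).symm

variable [HasPullbacks V]

lemma isVNatural_diagContra {f f' : Arrow C} (s : f ⟶ f') :
    IsVNatural V (diagContra V f) (diagContra V f') fun g => mapHom (diagCov V g.unop) s :=
  IsVNatural.toArrow (F := (opFunctor (codFunctor V C)).comp V (contraHom f.left))
    (F' := (opFunctor (codFunctor V C)).comp V (contraHom f'.left))
    (G := contraHom f) (G' := contraHom f') (τ := fun g => arrowDiag V g.unop f)
    (τ' := fun g => arrowDiag V g.unop f') _ _ (fun g => mapHom (diagCov V g.unop) s)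
    (by
      have h := (isVNatural_contraHom (V := V) s.left).functor_comp (opFunctor (codFunctor V C))
      exact h.congr fun g => (mapHom_diagCov_left g.unop s).symm)
    (by
      have h := isVNatural_contraHom (V := V) s
      exact h.congr fun g => (mapHom_diagCov_right g.unop s).symm)

end Representables

section AWFS

variable {V : Type u₁} [Category.{v₁} V] [MonoidalCategory V] [HasPullbacks V]
variable {C : Type u₂} [Category.{v₂} C] [EnrichedOrdinaryCategory V C]

namespace FunctorialFactorisation

variable (𝓕 : FunctorialFactorisation V C)

lemma Kmap_comp {f g h : Arrow C} (s : f ⟶ g) (t : g ⟶ h) :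
    𝓕.Kmap (s ≫ t) = 𝓕.Kmap s ≫ 𝓕.Kmap t := mapHom_comp 𝓕.K s t

/-- The action on a square of the endofunctor `f ↦ λ_f`, with its components displayed. -/
noncomputable abbrev Lmap {f g : Arrow C} (s : f ⟶ g) :
    Arrow.mk (𝓕.lam f) ⟶ Arrow.mk (𝓕.lam g) :=
  Arrow.homMk s.left (𝓕.Kmap s) (𝓕.lam_Kmap s).symm

/-- The action on a square of the endofunctor `f ↦ ρ_f`, with its components displayed. -/
noncomputable abbrev Rmap {f g : Arrow C} (s : f ⟶ g) :
    Arrow.mk (𝓕.rho f) ⟶ Arrow.mk (𝓕.rho g) :=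
  Arrow.homMk (𝓕.Kmap s) s.right (𝓕.Kmap_rho s).symm

lemma mapHom_L {f g : Arrow C} (s : f ⟶ g) : mapHom 𝓕.L s = 𝓕.Lmap s :=
  Arrow.hom_ext _ _ ((mapHom_toArrow_left _ _ _ _ s).trans (mapHom_domFunctor s))
    (mapHom_toArrow_right _ _ _ _ s)

lemma mapHom_R {f g : Arrow C} (s : f ⟶ g) : mapHom 𝓕.R s = 𝓕.Rmap s :=
  Arrow.hom_ext _ _ (mapHom_toArrow_left _ _ _ _ s)
    ((mapHom_toArrow_right _ _ _ _ s).trans (mapHom_codFunctor s))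

end FunctorialFactorisation

namespace AWFS

variable (𝓐 : AWFS V C)

lemma Kmap_sigma {f g : Arrow C} (s : f ⟶ g) :
    𝓐.Kmap s ≫ 𝓐.sigma g = 𝓐.sigma f ≫ 𝓐.Kmap (𝓐.Lmap s) :=
  mapHom_natural' 𝓐.K (𝓐.L.comp V 𝓐.K) 𝓐.sigma 𝓐.sigma_natural s _ (by
    rw [← 𝓐.mapHom_L]
    exact ((eHomEquiv_mapHom (𝓐.L.comp V 𝓐.K) s).symm.trans
      (congrArg _ (mapHom_functor_comp 𝓐.L 𝓐.K s))))

lemma Kmap_Rmap_pi {f g : Arrow C} (s : f ⟶ g) :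
    𝓐.Kmap (𝓐.Rmap s) ≫ 𝓐.pi g = 𝓐.pi f ≫ 𝓐.Kmap s := by
  rw [← 𝓐.mapHom_R]
  exact (congrArg (· ≫ 𝓐.pi g) (mapHom_functor_comp 𝓐.R 𝓐.K s)).symm.trans
    (mapHom_natural' (𝓐.R.comp V 𝓐.K) 𝓐.K 𝓐.pi 𝓐.pi_natural s _ (eHomEquiv_mapHom _ _).symm)

/-- The square `s : f ⟶ g` is a morphism of algebras for the monad on `R`, with respect to the
structure maps `p` and `q`. -/
def IsAlgHom {f g : Arrow C} (s : f ⟶ g) (p : 𝓐.K.obj f ⟶ f.left) (q : 𝓐.K.obj g ⟶ g.left) :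
    Prop :=
  𝓐.Kmap s ≫ q = p ≫ s.left

variable {𝓐}

lemma IsAlgHom.compStr {X Y Z X' Y' Z' : C} {f : X ⟶ Y} {g : Y ⟶ Z} {k : X ⟶ Z}
    {hk : f ≫ g = k} {f' : X' ⟶ Y'} {g' : Y' ⟶ Z'} {k' : X' ⟶ Z'} {hk' : f' ≫ g' = k'}
    {p : 𝓐.K.obj (Arrow.mk f) ⟶ X} {q : 𝓐.K.obj (Arrow.mk g) ⟶ Y}
    {hq : 𝓐.lam (Arrow.mk g) ≫ q = 𝟙 Y}
    {p' : 𝓐.K.obj (Arrow.mk f') ⟶ X'} {q' : 𝓐.K.obj (Arrow.mk g') ⟶ Y'}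
    {hq' : 𝓐.lam (Arrow.mk g') ≫ q' = 𝟙 Y'}
    {s : Arrow.mk f ⟶ Arrow.mk f'} {t : Arrow.mk g ⟶ Arrow.mk g'}
    (hs : 𝓐.IsAlgHom s p p') (ht : 𝓐.IsAlgHom t q q') (hst : s.right = t.left)
    (r : Arrow.mk k ⟶ Arrow.mk k') (hrs : r.left = s.left) (hrt : r.right = t.right) :
    𝓐.IsAlgHom r (𝓐.compStr f g k hk p q hq) (𝓐.compStr f' g' k' hk' p' q' hq') := by
  simp only [IsAlgHom] at hs ht
  have hsw : s.left ≫ f' = f ≫ t.left := by rw [← hst]; exact s.w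
  refine Eq.trans ?_ (congrArg (AWFS.compStr 𝓐 f g k hk p q hq ≫ ·) hrs.symm)
  rw [AWFS.compStr, AWFS.compStr, reassoc_of% (𝓐.Kmap_sigma r), ← reassoc_of% (𝓐.Kmap_comp),
    Category.assoc, Category.assoc, ← hs, ← reassoc_of% (𝓐.Kmap_comp)]
  congr 3
  refine Arrow.hom_ext _ _ ?_ ?_
  · simp [hrs]
  · simp only [Arrow.comp_right, Arrow.homMk_right, hst, Category.assoc]
    rw [← ht, ← reassoc_of% (𝓐.Kmap_comp), ← reassoc_of% (𝓐.Kmap_comp)]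
    congr 2
    exact Arrow.hom_ext _ _ (by simp [hrs, hsw]) (by simp [hrt])

variable (𝓐) in
/-- The condition on a family of squares under which structure maps on their common target, and
the equations between them, can be tested on their sources: it remains jointly epimorphic in the
domains, after `K`, and after `K R`. -/
structure JointlyAlgEpi {I : Type u₃} {g : Arrow C} {G : I → Arrow C} (s : ∀ d, G d ⟶ g) :
    Prop where
  left : JointlyEpi fun d => (s d).left
  Kmap : JointlyEpi fun d => 𝓐.Kmap (s d)
  Kmap_Rmap : JointlyEpi fun d => 𝓐.Kmap (𝓐.Rmap (s d))

lemma IsAlg.of_jointlyAlgEpi {I : Type u₃} {g : Arrow C} {G : I → Arrow C} {s : ∀ d, G d ⟶ g}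
    (hs : 𝓐.JointlyAlgEpi s) {q : ∀ d, 𝓐.K.obj (G d) ⟶ (G d).left}
    (hq : ∀ d, 𝓐.IsAlg (G d) (q d)) {p : 𝓐.K.obj g ⟶ g.left}
    (hp : ∀ d, 𝓐.IsAlgHom (s d) (q d) p) : 𝓐.IsAlg g p := by
  simp only [IsAlgHom] at hp
  have hom : p ≫ g.hom = 𝓐.rho g := hs.Kmap fun d => by
    rw [reassoc_of% hp d, ← 𝓐.Kmap_rho, Arrow.w, ← (hq d).comp_hom, Category.assoc]
  refine ⟨hom, hs.left fun d => ?_, hs.Kmap_Rmap fun d => ?_⟩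
  · rw [← Category.assoc, ← 𝓐.lam_Kmap, Category.assoc, hp, ← Category.assoc, (hq d).unit,
      Category.id_comp, Category.comp_id]
  · rw [reassoc_of% (𝓐.Kmap_Rmap_pi (s d)), hp, ← Category.assoc (𝓐.pi _), ← (hq d).assoc,
      Category.assoc, ← hp, ← reassoc_of% (𝓐.Kmap_comp), ← reassoc_of% (𝓐.Kmap_comp)]
    congr 2
    exact Arrow.hom_ext _ _ (by simp [hp]) (by simp)

end AWFS

end AWFS

section PulledBackStructures

variable {V : Type u₁} [Category.{v₁} V] [MonoidalCategory V] [HasPullbacks V]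
variable {C : Type u₂} [Category.{v₂} C] [EnrichedOrdinaryCategory V C]
variable {A B D : C} (g : A ⟶ B) (h : B ⟶ D) (k : A ⟶ D) (hk : g ≫ h = k)

lemma eHomWhiskerLeft_arrowPre {f f' : Arrow C} (s : f ⟶ f') :
    eHomWhiskerLeft V (Arrow.mk h) s ≫ arrowPre V g h k hk f' =
      arrowPre V g h k hk f ≫ eHomWhiskerLeft V (Arrow.mk k) s := by
  apply arrowHom_ext
  · rw [Category.assoc, Category.assoc, eHomWhiskerLeft_arrowFst, arrowPre, arrowPre,
      arrowLift_fst, reassoc_of% (arrowLift_fst V), reassoc_of% eHomWhiskerLeft_arrowFst (V := V),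
      Category.assoc]
    exact congrArg _ (eHom_whisker_exchange V g s.left)
  · rw [Category.assoc, Category.assoc, eHomWhiskerLeft_arrowSnd, arrowPre, arrowPre,
      arrowLift_snd, reassoc_of% (arrowLift_snd V), eHomWhiskerLeft_arrowSnd]
    rfl

lemma eHomWhiskerLeft_arrowSub {f f' : Arrow C} (s : f ⟶ f') :
    eHomWhiskerLeft V (Arrow.mk k) s ≫ arrowSub V g h k hk f' =
      arrowSub V g h k hk f ≫ eHomWhiskerLeft V (Arrow.mk g) s := by
  apply arrowHom_ext
  · rw [Category.assoc, Category.assoc, eHomWhiskerLeft_arrowFst, arrowSub, arrowSub,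
      arrowLift_fst, reassoc_of% (arrowLift_fst V), eHomWhiskerLeft_arrowFst]
    rfl
  · rw [Category.assoc, Category.assoc, eHomWhiskerLeft_arrowSnd, arrowSub, arrowSub,
      arrowLift_snd, reassoc_of% (arrowLift_snd V), reassoc_of% eHomWhiskerLeft_arrowSnd (V := V),
      Category.assoc]
    exact congrArg _ (eHom_whisker_exchange V h s.right)

/-- The action of a square `f ⟶ f'` on the arrow `C^2(h, f) ⟶ C^2(k, f)` given by
precomposition with `g`, where `k = h g`. -/
noncomputable abbrev arrowPreMap {f f' : Arrow C} (s : f ⟶ f') :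
    Arrow.mk (arrowPre V g h k hk f) ⟶ Arrow.mk (arrowPre V g h k hk f') :=
  Arrow.homMk (eHomWhiskerLeft V (Arrow.mk h) s) (eHomWhiskerLeft V (Arrow.mk k) s)
    (eHomWhiskerLeft_arrowPre g h k hk s)

lemma AWFS.IsAlgHom.pulledStr [MonoidalClosed V] {𝓜 : AWFS V V} {f f' : Arrow C} {s : f ⟶ f'}
    {p : 𝓜.K.obj (Arrow.mk (arrowDiag V (Arrow.mk g) f)) ⟶ (B ⟶[V] f.left)}
    {p' : 𝓜.K.obj (Arrow.mk (arrowDiag V (Arrow.mk g) f')) ⟶ (B ⟶[V] f'.left)}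
    (hp : 𝓜.IsAlg (Arrow.mk (arrowDiag V (Arrow.mk g) f)) p)
    (hp' : 𝓜.IsAlg (Arrow.mk (arrowDiag V (Arrow.mk g) f')) p')
    (hs : 𝓜.IsAlgHom (mapHom (diagCov V (Arrow.mk g)) s) p p') :
    𝓜.IsAlgHom (arrowPreMap g h k hk s) (EnrichedAWFS.pulledStr 𝓜 g h k hk f p hp)
      (EnrichedAWFS.pulledStr 𝓜 g h k hk f' p' hp') := by
  change 𝓜.Kmap _ ≫ _ = _ ≫ eHomWhiskerLeft V (Arrow.mk h) s
  apply arrowHom_ext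
  · rw [Category.assoc, Category.assoc, eHomWhiskerLeft_arrowFst,
      EnrichedAWFS.pulledStr, EnrichedAWFS.pulledStr,
      arrowLift_fst, reassoc_of% (arrowLift_fst V), Category.assoc]
    refine Eq.trans ?_ (congrArg _ (hs.trans
      (congrArg (p ≫ ·) (mapHom_diagCov_left (V := V) (Arrow.mk g) s))))
    rw [← reassoc_of% (𝓜.Kmap_comp)]
    refine Eq.trans ?_ ((congrArg (· ≫ p') (𝓜.Kmap_comp _ _)).trans (Category.assoc _ _ _))
    refine congrArg (𝓜.Kmap · ≫ p') (Arrow.hom_ext _ _ ?_ ?_)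
    · refine (eHomWhiskerLeft_arrowFst _ _).trans ?_
      exact congrArg _ (mapHom_diagCov_left (V := V) (Arrow.mk g) s).symm
    · refine (eHomWhiskerLeft_arrowSub g h k hk s).trans ?_
      exact congrArg _ (mapHom_diagCov_right (V := V) (Arrow.mk g) s).symm
  · rw [Category.assoc, Category.assoc, eHomWhiskerLeft_arrowSnd,
      EnrichedAWFS.pulledStr, EnrichedAWFS.pulledStr,
      arrowLift_snd, reassoc_of% (arrowLift_snd V), Category.assoc, ← Category.assoc, ← 𝓜.Kmap_rho,
      Category.assoc]
    exact congrArg _ (eHomWhiskerLeft_arrowSnd (Arrow.mk k) s)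

end PulledBackStructures

section Rank

variable {C : Type u₁} [Category.{v₁} C] {B : Type u₂} [Category.{v₂} B]

lemma exists_isRegular_forall_le {I : Type u₃} [Small.{w} I] (κ : I → Cardinal.{w}) :
    ∃ (κ' : Cardinal.{w}) (_ : Fact κ'.IsRegular), ∀ i, κ i ≤ κ' := by
  obtain ⟨κ', hκ', h⟩ := HasCardinalLT.exists_regular_cardinal_forall.{w} fun i => (κ i).ord.ToType
  exact ⟨κ', ⟨hκ'⟩, fun i => by simpa [hasCardinalLT_iff_cardinal_mk_lt] using (h i).le⟩

/-- `Φ` has rank at most `κ` with respect to `M`: it preserves the colimits of the small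
`κ`-filtered diagrams that have a cocone with components in `M`. For `Φ = C(A, -)` this is
`HasRankLE M A κ`. -/
def FunctorHasRankLE (M : MorphismProperty C) (Φ : C ⥤ B) (κ : Cardinal.{w}) [Fact κ.IsRegular] :
    Prop :=
  ∀ (𝒟 : Type w) [SmallCategory 𝒟] [IsCardinalFiltered 𝒟 κ] (X : 𝒟 ⥤ C) (m : Cocone X),
    (∀ d, M (m.ι.app d)) → PreservesColimit X Φ

namespace FunctorHasRankLE

variable {M : MorphismProperty C} {κ : Cardinal.{w}} [Fact κ.IsRegular]

lemma of_le {Φ : C ⥤ B} {κ' : Cardinal.{w}} [Fact κ'.IsRegular]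
    (hΦ : FunctorHasRankLE M Φ κ) (h : κ ≤ κ') : FunctorHasRankLE M Φ κ' :=
  fun 𝒟 _ _ X m hm =>
    have : IsCardinalFiltered 𝒟 κ := IsCardinalFiltered.of_le 𝒟 h
    hΦ 𝒟 X m hm

lemma of_iso {Φ Ψ : C ⥤ B} (e : Φ ≅ Ψ) (hΦ : FunctorHasRankLE M Φ κ) :
    FunctorHasRankLE M Ψ κ := fun 𝒟 _ _ X m hm =>
  have := hΦ 𝒟 X m hm
  preservesColimit_of_natIso X e

lemma comp_left {D : Type u₃} [Category.{v₃} D] {N : MorphismProperty D} {Φ : C ⥤ B}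
    (hΦ : FunctorHasRankLE M Φ κ) (H : D ⥤ C) [PreservesColimitsOfSize.{w, w} H]
    (h : N ≤ M.inverseImage H) : FunctorHasRankLE N (H ⋙ Φ) κ := fun 𝒟 _ _ X m hm =>
  have := hΦ 𝒟 (X ⋙ H) (H.mapCocone m) fun d => h _ (hm d)
  inferInstance

lemma of_isPullback {W X Y Z : C ⥤ Type v₃} {fst : W ⟶ X} {snd : W ⟶ Y} {f : X ⟶ Z} {g : Y ⟶ Z}
    (sq : ∀ A, IsPullback (fst.app A) (snd.app A) (f.app A) (g.app A))
    (hX : FunctorHasRankLE M X κ) (hY : FunctorHasRankLE M Y κ) (hZ : FunctorHasRankLE M Z κ) :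
    FunctorHasRankLE M W κ := fun 𝒟 _ _ T m hm => ⟨fun {c} hc => by
  have w : fst ≫ f = snd ≫ g := NatTrans.ext (funext fun A => (sq A).w)
  have := hX 𝒟 T m hm
  have := hY 𝒟 T m hm
  have := hZ 𝒟 T m hm
  refine ⟨Functor.Accessible.Limits.isColimitMapCocone (F := cospan f g) (PullbackCone.mk _ _ w)
    (fun A => (isLimitMapConePullbackConeEquiv _ w).symm (sq A).isLimit) κ ?_ c ?_⟩
  · exact hasCardinalLT_of_finite _ _ (Fact.out : κ.IsRegular).aleph0_le
  · rintro (_ | _ | _)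
    exacts [isColimitOfPreserves Z hc, isColimitOfPreserves X hc, isColimitOfPreserves Y hc]⟩

end FunctorHasRankLE

/-- The functors `B(G n, -)` jointly reflect small `κ`-filtered colimits. -/
def JointlyReflectFilteredColimits {I : Type u₃} (G : I → B) (κ : Cardinal.{w})
    [Fact κ.IsRegular] : Prop :=
  ∀ ⦃𝒟 : Type w⦄ [SmallCategory 𝒟] [IsCardinalFiltered 𝒟 κ] ⦃X : 𝒟 ⥤ B⦄ (c : Cocone X),
    (∀ n, Nonempty (IsColimit ((coyoneda.obj (op (G n))).mapCocone c))) → Nonempty (IsColimit c)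

namespace JointlyReflectFilteredColimits

variable {I : Type u₃} {G : I → B} {κ : Cardinal.{w}} [Fact κ.IsRegular]

lemma of_le {κ' : Cardinal.{w}} [Fact κ'.IsRegular] (hG : JointlyReflectFilteredColimits G κ)
    (h : κ ≤ κ') : JointlyReflectFilteredColimits G κ' := fun 𝒟 _ _ _ c hc =>
  have : IsCardinalFiltered 𝒟 κ := IsCardinalFiltered.of_le 𝒟 h
  hG c hc

lemma functorHasRankLE (hG : JointlyReflectFilteredColimits G κ) {M : MorphismProperty C}
    {Φ : C ⥤ B} (hΦ : ∀ n, FunctorHasRankLE M (Φ ⋙ coyoneda.obj (op (G n))) κ) :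
    FunctorHasRankLE M Φ κ := fun 𝒟 _ _ X m hm => ⟨fun {_} hc => hG _ fun n =>
  have := hΦ n 𝒟 X m hm
  ⟨isColimitOfPreserves (Φ ⋙ coyoneda.obj (op (G n))) hc⟩⟩

end JointlyReflectFilteredColimits

end Rank

section Tensor

variable {V : Type u₁} [Category.{v₁} V] [MonoidalCategory V] [MonoidalClosed V]
variable {C : Type u₂} [Category.{v₁} C] [EnrichedOrdinaryCategory V C]

/-- The morphism `η : v ⟶ C(X, T)` exhibits `T` as the tensor `v ⊗ X`: it induces isomorphisms
`C(T, Y) ≅ [v, C(X, Y)]`. -/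
def IsTensor {v : V} {X T : C} (η : v ⟶ (X ⟶[V] T)) : Prop :=
  ∀ Y : C, IsIso (MonoidalClosed.curry (η ▷ (T ⟶[V] Y) ≫ eComp V X T Y))

lemma eHomEquiv_comp_curry {v : V} {X T : C} (η : v ⟶ (X ⟶[V] T)) {Y : C} (f : T ⟶ Y) :
    eHomEquiv V f ≫ MonoidalClosed.curry (η ▷ (T ⟶[V] Y) ≫ eComp V X T Y) =
      MonoidalClosed.curry ((ρ_ v).hom ≫ η ≫ eHomWhiskerLeft V X f) := by
  rw [← MonoidalClosed.curry_natural_left, whisker_exchange_assoc, eHomWhiskerLeft,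
    rightUnitor_inv_naturality_assoc]
  simp

namespace IsTensor

variable {v : V} {X T : C} {η : v ⟶ (X ⟶[V] T)} (h : IsTensor η)
include h

lemma bijective (Y : C) :
    Function.Bijective fun f : T ⟶ Y => η ≫ eHomWhiskerLeft V X f := by
  have := h Y
  let e : (T ⟶ Y) ≃ (v ⟶ (X ⟶[V] Y)) :=
    (eHomEquiv V).trans <| (asIso (MonoidalClosed.curry (η ▷ (T ⟶[V] Y) ≫
      eComp V X T Y))).homToEquiv.trans <|
      ((ihom.adjunction v).homEquiv _ _).symm.trans (ρ_ v).homFromEquiv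
  convert e.bijective using 2 with f
  have hf := congrArg MonoidalClosed.uncurry (eHomEquiv_comp_curry η f)
  rw [MonoidalClosed.uncurry_curry] at hf
  exact ((congrArg ((ρ_ v).inv ≫ ·) hf).trans (by simp)).symm

/-- The isomorphism `C(v ⊗ X, -) ≅ V(v, C(X, -))`. -/
noncomputable def coyonedaIso :
    coyoneda.obj (op T) ≅ (eHomFunctor V C).obj (op X) ⋙ coyoneda.obj (op v) :=
  NatIso.ofComponents (fun Y => (Equiv.ofBijective _ (h.bijective Y)).toIso) fun {Y Y'} s => by
    ext f
    change η ≫ eHomWhiskerLeft V X (f ≫ s) = (η ≫ eHomWhiskerLeft V X f) ≫ eHomWhiskerLeft V X s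
    rw [eHomWhiskerLeft_comp, Category.assoc]

end IsTensor

lemma exists_functorHasRankLE_eHomFunctor {M : MorphismProperty C}
    (hM : ∀ A : C, ∃ (κ : Cardinal.{w}) (_ : Fact κ.IsRegular), HasRankLE M A κ)
    (hC : ∀ (v : V) (X : C), ∃ (T : C) (η : v ⟶ (X ⟶[V] T)), IsTensor η)
    {I : Type u₃} [Small.{w} I] {I' : Type u₄} [Small.{w} I'] (A : I → C) (G : I' → V) :
    ∃ (κ : Cardinal.{w}) (_ : Fact κ.IsRegular), ∀ i n,
      FunctorHasRankLE M ((eHomFunctor V C).obj (op (A i)) ⋙ coyoneda.obj (op (G n))) κ := by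
  choose T η hη using hC
  choose κ hκ hT using fun p : I × I' => hM (T (G p.2) (A p.1))
  obtain ⟨κ', hκ', hle⟩ := exists_isRegular_forall_le κ
  refine ⟨κ', hκ', fun i n => ?_⟩
  have hrank : FunctorHasRankLE M (coyoneda.obj (op (T (G n) (A i)))) (κ (i, n)) := hT (i, n)
  exact (hrank.of_le (hle (i, n))).of_iso (hη (G n) (A i)).coyonedaIso

end Tensor

section ArrowRank

variable {C : Type u₂} [Category.{v₂} C]

/-- The squares both of whose components belong to `M`. -/
def componentwise (M : MorphismProperty C) : MorphismProperty (Arrow C) :=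
  fun _ _ s => M s.left ∧ M s.right

variable {V : Type u₁} [Category.{v₁} V] [MonoidalCategory V] [HasPullbacks V]
  [EnrichedOrdinaryCategory V C]

lemma isPullback_arrowHom (f g : Arrow C) :
    IsPullback (arrowFst V f g) (arrowSnd V f g) (eHomWhiskerLeft V f.left g.hom)
      (eHomWhiskerRight V f.hom g.right) :=
  IsPullback.of_hasPullback _ _

variable [HasColimitsOfSize.{w, w} C]

lemma FunctorHasRankLE.eHomFunctor_arrow {M : MorphismProperty C} {κ : Cardinal.{w}}
    [Fact κ.IsRegular] (g : Arrow C) (T : V)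
    (hl : FunctorHasRankLE M ((eHomFunctor V C).obj (op g.left) ⋙ coyoneda.obj (op T)) κ)
    (hr : FunctorHasRankLE M ((eHomFunctor V C).obj (op g.right) ⋙ coyoneda.obj (op T)) κ) :
    FunctorHasRankLE (componentwise M)
      ((eHomFunctor V (Arrow C)).obj (op g) ⋙ coyoneda.obj (op T)) κ := by
  have : PreservesColimitsOfSize.{w, w} (Arrow.leftFunc : Arrow C ⥤ C) := ⟨inferInstance⟩
  have : PreservesColimitsOfSize.{w, w} (Arrow.rightFunc : Arrow C ⥤ C) := ⟨inferInstance⟩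
  let fst : (eHomFunctor V (Arrow C)).obj (op g) ⟶
      Arrow.leftFunc ⋙ (eHomFunctor V C).obj (op g.left) :=
    { app f := arrowFst V g f, naturality _ _ s := eHomWhiskerLeft_arrowFst g s }
  let snd : (eHomFunctor V (Arrow C)).obj (op g) ⟶
      Arrow.rightFunc ⋙ (eHomFunctor V C).obj (op g.right) :=
    { app f := arrowSnd V g f, naturality _ _ s := eHomWhiskerLeft_arrowSnd g s }
  refine .of_isPullback
    (fst := Functor.whiskerRight fst (coyoneda.obj (op T)))
    (snd := Functor.whiskerRight snd (coyoneda.obj (op T)))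
    (f := Functor.whiskerRight (Functor.whiskerRight Arrow.leftToRight
      ((eHomFunctor V C).obj (op g.left))) (coyoneda.obj (op T)))
    (g := Functor.whiskerRight (Functor.whiskerLeft Arrow.rightFunc
      ((eHomFunctor V C).map g.hom.op)) (coyoneda.obj (op T)))
    (fun f => (isPullback_arrowHom g f).map (coyoneda.obj (op T)))
    (hl.comp_left Arrow.leftFunc fun _ _ _ h => h.1)
    (hr.comp_left Arrow.rightFunc fun _ _ _ h => h.2)
    (hl.comp_left Arrow.rightFunc fun _ _ _ h => h.2)

end ArrowRank

section EnrichedEpi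

/-- The enriched analogue of `JointlyEpi`: the maps `C(Y, Z) ⟶ C(X d, Z)` given by precomposition
with the members of the family are jointly monomorphic for every `Z`. -/
def JointlyVEpi (V : Type u₁) [Category.{v₁} V] [MonoidalCategory V] {C : Type u₂} [Category.{v₂} C]
    [EnrichedOrdinaryCategory V C] {I : Type u₃} {X : I → C} {Y : C} (s : ∀ d, X d ⟶ Y) : Prop :=
  ∀ ⦃Z : C⦄ ⦃T : V⦄ ⦃a b : T ⟶ (Y ⟶[V] Z)⦄,
    (∀ d, a ≫ eHomWhiskerRight V (s d) Z = b ≫ eHomWhiskerRight V (s d) Z) → a = b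

lemma JointlyEpi.jointlyVEpi {V : Type u₁} [Category.{v₁} V] [MonoidalCategory V] [MonoidalClosed V]
    [BraidedCategory V] {I : Type u₃} {X : I → V} {Y : V} {s : ∀ d, X d ⟶ Y} (hs : JointlyEpi s) :
    JointlyVEpi V s := by
  intro Z T a b hab
  have uncurry_whisker (l : T ⟶ (ihom Y).obj Z) (d : I) :
      MonoidalClosed.uncurry (l ≫ eHomWhiskerRight V (s d) Z) =
        s d ▷ T ≫ MonoidalClosed.uncurry l := by
    rw [MonoidalClosed.enrichedOrdinaryCategorySelf_eHomWhiskerRight]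
    exact MonoidalClosed.uncurry_pre_app (A := Y) (B := X d) (X := Z) l (s d)
  have hab' (d : I) : s d ▷ T ≫ MonoidalClosed.uncurry a = s d ▷ T ≫ MonoidalClosed.uncurry b :=
    (uncurry_whisker a d).symm.trans
      ((congrArg MonoidalClosed.uncurry (hab d)).trans (uncurry_whisker b d))
  apply MonoidalClosed.uncurry_injective
  rw [← cancel_epi (β_ T Y).hom]
  apply MonoidalClosed.curry_injective
  refine hs fun d => ?_
  rw [← MonoidalClosed.curry_natural_left, ← MonoidalClosed.curry_natural_left,
    BraidedCategory.braiding_naturality_right_assoc,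
    BraidedCategory.braiding_naturality_right_assoc, hab' d]

variable {V : Type u₁} [Category.{v₁} V] [MonoidalCategory V]
variable {C : Type u₂} [Category.{v₂} C] [EnrichedOrdinaryCategory V C]

lemma JointlyVEpi.arrow [HasPullbacks V] {I : Type u₃} {G : I → Arrow C} {g : Arrow C}
    {s : ∀ d, G d ⟶ g} (hl : JointlyVEpi V fun d => (s d).left)
    (hr : JointlyVEpi V fun d => (s d).right) : JointlyVEpi V s := by
  intro f T a b hab
  refine arrowHom_ext V (hl fun d => ?_) (hr fun d => ?_)
  · rw [Category.assoc, Category.assoc, ← eHomWhiskerRight_arrowFst, reassoc_of% hab d]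
  · rw [Category.assoc, Category.assoc, ← eHomWhiskerRight_arrowSnd, reassoc_of% hab d]

lemma IsVNatural.of_jointlyVEpi {B : Type u₄} [EnrichedCategory V B] {I : Type u₃}
    {F G : EnrichedFunctor V B C} {F' G' : I → EnrichedFunctor V B C}
    {τ : ∀ b, F.obj b ⟶ G.obj b} {τ' : ∀ d b, (F' d).obj b ⟶ (G' d).obj b}
    {α : ∀ d b, (F' d).obj b ⟶ F.obj b} {β : ∀ d b, (G' d).obj b ⟶ G.obj b}
    (hτ' : ∀ d, IsVNatural V (F' d) (G' d) (τ' d)) (hα : ∀ d, IsVNatural V (F' d) F (α d))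
    (hβ : ∀ d, IsVNatural V (G' d) G (β d)) (w : ∀ d b, α d b ≫ τ b = τ' d b ≫ β d b)
    (hs : ∀ b, JointlyVEpi V fun d => α d b) : IsVNatural V F G τ := fun b b' => hs b fun d => by
  rw [Category.assoc, Category.assoc, eHom_whisker_exchange, ← eHomWhiskerRight_comp, w,
    ← reassoc_of% (hα d b b'), ← eHomWhiskerLeft_comp, w, eHomWhiskerLeft_comp,
    reassoc_of% (hτ' d b b'), ← eHom_whisker_exchange, reassoc_of% (hβ d b b'),
    eHomWhiskerRight_comp]

end EnrichedEpi

section Conical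

variable {V : Type u₁} [Category.{v₁} V] [MonoidalCategory V]
variable {C : Type u₂} [Category.{v₂} C] [EnrichedOrdinaryCategory V C]
variable {𝒟 : Type u₃} [Category.{v₃} 𝒟]

namespace IsConicalColimit

lemma jointlyVEpi {F : 𝒟 ⥤ C} {c : Cocone F} (h : IsConicalColimit V c) :
    JointlyVEpi V c.ι.app := fun Y _ _ _ hab => (h Y).some.hom_ext fun d => hab d.unop

lemma exists_desc {F : 𝒟 ⥤ C} {c : Cocone F} (h : IsConicalColimit V c) {Y : C} {T : V}
    (a : ∀ d, T ⟶ (F.obj d ⟶[V] Y))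
    (ha : ∀ ⦃d d' : 𝒟⦄ (φ : d ⟶ d'), a d' ≫ eHomWhiskerRight V (F.map φ) Y = a d) :
    ∃ l : T ⟶ (c.pt ⟶[V] Y), ∀ d, l ≫ eHomWhiskerRight V (c.ι.app d) Y = a d := by
  let s : Cone (F.op ⋙ (eHomFunctor V C).flip.obj Y) :=
    { pt := T
      π := { app d := a d.unop
             naturality _ _ φ := (Category.id_comp _).trans (ha φ.unop).symm } }
  exact ⟨(h Y).some.lift s, fun d => (h Y).some.fac s (op d)⟩

lemma of_jointlyVEpi {F : 𝒟 ⥤ C} {c : Cocone F} (hc : JointlyVEpi V c.ι.app)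
    (h : ∀ ⦃Y : C⦄ ⦃T : V⦄ (a : ∀ d, T ⟶ (F.obj d ⟶[V] Y)),
      (∀ ⦃d d' : 𝒟⦄ (φ : d ⟶ d'), a d' ≫ eHomWhiskerRight V (F.map φ) Y = a d) →
        ∃ l : T ⟶ (c.pt ⟶[V] Y), ∀ d, l ≫ eHomWhiskerRight V (c.ι.app d) Y = a d) :
    IsConicalColimit V c := fun Y => by
  choose l hl using fun s : Cone (F.op ⋙ (eHomFunctor V C).flip.obj Y) =>
    h (fun d => s.π.app (op d)) fun _ _ φ => s.w φ.op
  exact ⟨{ lift := l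
           fac s d := hl s d.unop
           uniq s _ hm := hc fun d => (hm (op d)).trans (hl s d).symm }⟩

lemma nonempty_isColimit {F : 𝒟 ⥤ C} {c : Cocone F} (h : IsConicalColimit V c) :
    Nonempty (IsColimit c) := by
  choose l hl using fun s : Cocone F => h.exists_desc (fun d => eHomEquiv V (s.ι.app d))
    fun _ _ φ => by rw [eHomEquiv_whiskerRight, s.w]
  have fac (s : Cocone F) (m : c.pt ⟶ s.pt) (d : 𝒟) : c.ι.app d ≫ m = s.ι.app d ↔
      eHomEquiv V m ≫ eHomWhiskerRight V (c.ι.app d) s.pt = eHomEquiv V (s.ι.app d) := by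
    rw [eHomEquiv_whiskerRight, (eHomEquiv V).apply_eq_iff_eq]
  refine ⟨{ desc s := (eHomEquiv V).symm (l s), fac s d := ?_, uniq s m hm := ?_ }⟩
  · rw [fac, Equiv.apply_symm_apply, hl]
  · rw [Equiv.eq_symm_apply]
    exact h.jointlyVEpi fun d => ((fac s m d).1 (hm d)).trans (hl s d).symm

lemma of_isColimit {F : 𝒟 ⥤ C} {c₀ c : Cocone F} (h : IsConicalColimit V c₀) (hc : IsColimit c) :
    IsConicalColimit V c := fun Y => by
  obtain ⟨h₀⟩ := h.nonempty_isColimit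
  let e : c.pt ≅ c₀.pt := hc.coconePointUniqueUpToIso h₀
  refine (h Y).map fun hY => hY.ofIsoLimit
    (Cone.ext (((eHomFunctor V C).flip.obj Y).mapIso e.op) fun d => ?_)
  refine Eq.trans ?_ (((eHomFunctor V C).flip.obj Y).map_comp e.op.hom (c.ι.app d.unop).op)
  rw [Iso.op_hom, ← op_comp, hc.comp_coconePointUniqueUpToIso_hom h₀]
  rfl

lemma arrow [HasPullbacks V] {F : 𝒟 ⥤ Arrow C} {c : Cocone F}
    (hl : IsConicalColimit V (Arrow.leftFunc.mapCocone c))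
    (hr : IsConicalColimit V (Arrow.rightFunc.mapCocone c)) : IsConicalColimit V c := by
  refine of_jointlyVEpi (.arrow hl.jointlyVEpi hr.jointlyVEpi) fun Y T a ha => ?_
  obtain ⟨x, hx⟩ : ∃ x : T ⟶ (c.pt.left ⟶[V] Y.left), ∀ d,
      x ≫ eHomWhiskerRight V (c.ι.app d).left Y.left = a d ≫ arrowFst V (F.obj d) Y :=
    hl.exists_desc (fun d => a d ≫ arrowFst V (F.obj d) Y) fun d d' φ => by
      change (a d' ≫ arrowFst V (F.obj d') Y) ≫ eHomWhiskerRight V (F.map φ).left Y.left =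
        a d ≫ arrowFst V (F.obj d) Y
      rw [← ha φ, Category.assoc, Category.assoc, eHomWhiskerRight_arrowFst]
  obtain ⟨y, hy⟩ : ∃ y : T ⟶ (c.pt.right ⟶[V] Y.right), ∀ d,
      y ≫ eHomWhiskerRight V (c.ι.app d).right Y.right = a d ≫ arrowSnd V (F.obj d) Y :=
    hr.exists_desc (fun d => a d ≫ arrowSnd V (F.obj d) Y) fun d d' φ => by
      change (a d' ≫ arrowSnd V (F.obj d') Y) ≫ eHomWhiskerRight V (F.map φ).right Y.right =
        a d ≫ arrowSnd V (F.obj d) Y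
      rw [← ha φ, Category.assoc, Category.assoc, eHomWhiskerRight_arrowSnd]
  have hxy : x ≫ eHomWhiskerLeft V c.pt.left Y.hom = y ≫ eHomWhiskerRight V c.pt.hom Y.right := by
    refine hl.jointlyVEpi fun d => ?_
    change _ ≫ eHomWhiskerRight V (c.ι.app d).left _ = _ ≫ eHomWhiskerRight V (c.ι.app d).left _
    have hw : (c.ι.app d).left ≫ c.pt.hom = (F.obj d).hom ≫ (c.ι.app d).right :=
      Arrow.w (c.ι.app d)
    rw [Category.assoc, Category.assoc, ← eHomWhiskerRight_comp, hw, eHomWhiskerRight_comp,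
      reassoc_of% hy, eHom_whisker_exchange, reassoc_of% hx, arrow_condition]
  refine ⟨arrowLift V x y hxy, fun d => arrowHom_ext V ?_ ?_⟩
  · rw [Category.assoc, eHomWhiskerRight_arrowFst, ← hx d, ← Category.assoc]
    exact congrArg (· ≫ _) (arrowLift_fst V x y hxy)
  · rw [Category.assoc, eHomWhiskerRight_arrowSnd, ← hy d, ← Category.assoc]
    exact congrArg (· ≫ _) (arrowLift_snd V x y hxy)

lemma fullSubcategory {Q : ObjectProperty C} {F : 𝒟 ⥤ Q.FullSubcategory} {c : Cocone F}
    (h : IsConicalColimit V (Q.ι.mapCocone c)) : IsConicalColimit V c :=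
  fun Y => h Y.obj

end IsConicalColimit

end Conical

section Inserter

variable {V : Type u₁} [Category.{v₁} V] [MonoidalCategory V]
variable {D : Type u₂} [Category.{v₂} D] [EnrichedOrdinaryCategory V D]
variable {E : Type u₃} [Category.{v₃} E] [EnrichedOrdinaryCategory V E]
variable {I : Type w} {F G : I → EnrichedFunctor V D E}

namespace Inserter

lemma Commutes.of_jointlyVEpi {I' : Type u₄} {X : I' → Inserter F G} {x y : Inserter F G}
    {s : ∀ d, X d ⟶ x} (hF : ∀ i, JointlyVEpi V fun d => mapHom (F i) (s d).hom) {T : V}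
    {l : T ⟶ (x.obj ⟶[V] y.obj)}
    (h : ∀ d, Commutes (x := X d) (y := y) (l ≫ eHomWhiskerRight V (s d).hom y.obj)) :
    Commutes (x := x) (y := y) l := fun i => hF i fun d => by
  have hd := h d i
  rw [Category.assoc, Category.assoc, ← reassoc_of% map_eHomWhiskerRight (F i),
    ← reassoc_of% map_eHomWhiskerRight (G i)] at hd
  rw [Category.assoc, Category.assoc, Category.assoc, Category.assoc, eHom_whisker_exchange, hd,
    ← eHomWhiskerRight_comp, ← eHomWhiskerRight_comp, (s d).comm]

variable [HasEqualizers V] [HasProductsOfShape I V]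

variable (V F G) in
/-- The forgetful functor of the inserter as a `V`-functor. -/
noncomputable def enrichedForget : EnrichedFunctor V (Inserter F G) D where
  obj x := x.obj
  map x y := homIncl x y
  map_id x := homLift_incl _ (commutes_id x)
  map_comp x y z := homComp_incl x y z

lemma mapHom_enrichedForget {x y : Inserter F G} (s : x ⟶ y) :
    mapHom (enrichedForget V F G) s = s.hom :=
  (eHomEquiv V).injective ((eHomEquiv_mapHom _ _).trans (homEquiv_incl s))

lemma eHomWhiskerRight_homIncl {x x' : Inserter F G} (s : x ⟶ x') (y : Inserter F G) :
    eHomWhiskerRight V s y ≫ homIncl x y = homIncl x' y ≫ eHomWhiskerRight V s.hom y.obj := by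
  rw [← mapHom_enrichedForget (V := V) s]
  exact (map_eHomWhiskerRight (enrichedForget V F G) s y).symm

lemma jointlyVEpi_of_hom {I' : Type u₄} {X : I' → Inserter F G} {x : Inserter F G}
    {s : ∀ d, X d ⟶ x} (hs : JointlyVEpi V fun d => (s d).hom) : JointlyVEpi V s := by
  intro y T a b hab
  refine homObj_ext (hs fun d => ?_)
  rw [Category.assoc, Category.assoc, ← eHomWhiskerRight_homIncl, reassoc_of% hab d]

lemma isConicalColimit_of_forget {𝒟 : Type u₄} [Category.{v₄} 𝒟] {X : 𝒟 ⥤ Inserter F G}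
    {c : Cocone X} (hc : IsConicalColimit V ((forget F G).mapCocone c))
    (hF : ∀ i, JointlyVEpi V ((underlying (F i)).mapCocone ((forget F G).mapCocone c)).ι.app) :
    IsConicalColimit V c := by
  refine .of_jointlyVEpi (jointlyVEpi_of_hom hc.jointlyVEpi) fun y T a ha => ?_
  obtain ⟨l, hl⟩ : ∃ l : T ⟶ (c.pt.obj ⟶[V] y.obj), ∀ d,
      l ≫ eHomWhiskerRight V (c.ι.app d).hom y.obj = a d ≫ homIncl (X.obj d) y :=
    hc.exists_desc (fun d => a d ≫ homIncl (X.obj d) y) fun d d' φ => by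
      change (a d' ≫ homIncl (X.obj d') y) ≫ eHomWhiskerRight V (X.map φ).hom y.obj =
        a d ≫ homIncl (X.obj d) y
      rw [← ha φ, Category.assoc, Category.assoc, eHomWhiskerRight_homIncl]
  have comm : Commutes (x := c.pt) (y := y) l := .of_jointlyVEpi hF fun d i => by
    rw [hl d, Category.assoc, Category.assoc, commutes_homIncl (X.obj d) y i]
  refine ⟨homLift l comm, fun d => homObj_ext ?_⟩
  rw [Category.assoc, eHomWhiskerRight_homIncl, ← hl d, ← Category.assoc]
  exact congrArg (· ≫ _) (homLift_incl l comm)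

end Inserter

end Inserter

section Pitchfork

variable {V : Type u₁} [Category.{v₁} V] [MonoidalCategory V] [MonoidalClosed V] [HasPullbacks V]
variable {C : Type u₂} [Category.{v₂} C] [EnrichedOrdinaryCategory V C]
variable {J : InternalCat.{v₁, u₁, w} V} (𝓜 : AWFS V V) (U : J.ToSq C)

/-- The action of `s : f ⟶ f'` on the arrow `W_i(f) : C(cod U i, dom f) ⟶ C^2(U i, f)`. -/
noncomputable abbrev wMap (i : J.Arr) {f f' : Arrow C} (s : f ⟶ f') : wArr U i f ⟶ wArr U i f' :=
  mapHom (diagCov V (U.arrFunctor.obj i)) s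

lemma wMap_left (i : J.Arr) {f f' : Arrow C} (s : f ⟶ f') :
    (wMap U i s).left = eHomWhiskerLeft V (U.arrFunctor.obj i).right s.left :=
  mapHom_diagCov_left _ s

lemma wMap_right (i : J.Arr) {f f' : Arrow C} (s : f ⟶ f') :
    (wMap U i s).right = eHomWhiskerLeft V (U.arrFunctor.obj i) s :=
  mapHom_diagCov_right _ s

lemma mapHom_srcStr (i : J.Arr) {f f' : Arrow C} (s : f ⟶ f') :
    mapHom (srcStr 𝓜 U i) s = 𝓜.Kmap (wMap U i s) := mapHom_functor_comp _ _ s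

lemma mapHom_tgtStr (i : J.Arr) {f f' : Arrow C} (s : f ⟶ f') :
    mapHom (tgtStr (V := V) U i) s = (wMap U i s).left :=
  (mapHom_functor_comp (domFunctor V C) (covHom (U.arrFunctor.obj i).right) s).trans
    ((congrArg _ (mapHom_domFunctor s)).trans ((mapHom_covHom _ _).trans (wMap_left U i s).symm))

variable {𝓜 U}

lemma isAlgHom_wMap_iff {x y : Inserter (srcStr 𝓜 U) (tgtStr (V := V) U)} {s : x.obj ⟶ y.obj}
    {i : J.Arr} : 𝓜.IsAlgHom (wMap U i s) (x.str i) (y.str i) ↔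
      mapHom (srcStr 𝓜 U i) s ≫ y.str i = x.str i ≫ mapHom (tgtStr (V := V) U i) s := by
  rw [mapHom_srcStr, mapHom_tgtStr]
  rfl

lemma isAlgHom_compStr_pulledStr {f f' : Arrow C} (s : f ⟶ f') {a b d : J.Obj} (i : J.Ver a b)
    (j : J.Ver b d) {p : 𝓜.K.obj (wArr U (J.ar i) f) ⟶ (wArr U (J.ar i) f).left}
    {p' : 𝓜.K.obj (wArr U (J.ar i) f') ⟶ (wArr U (J.ar i) f').left}
    (hp : 𝓜.IsAlg _ p) (hp' : 𝓜.IsAlg _ p')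
    {q : 𝓜.K.obj (wArr U (J.ar j) f) ⟶ (wArr U (J.ar j) f).left}
    {q' : 𝓜.K.obj (wArr U (J.ar j) f') ⟶ (wArr U (J.ar j) f').left}
    (hi : 𝓜.IsAlgHom (wMap U (J.ar i) s) p p') (hj : 𝓜.IsAlgHom (wMap U (J.ar j) s) q q') :
    𝓜.IsAlgHom (wMap U (J.ar (J.vcomp i j)) s)
      (𝓜.compStr _ _ _ (arrowDiag_pre V _ _ _ (U.arrMap_vcomp i j).symm f) q
        (pulledStr 𝓜 _ _ _ _ f p hp) (lam_pulledStr 𝓜 _ _ _ _ f p hp))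
      (𝓜.compStr _ _ _ (arrowDiag_pre V _ _ _ (U.arrMap_vcomp i j).symm f') q'
        (pulledStr 𝓜 _ _ _ _ f' p' hp') (lam_pulledStr 𝓜 _ _ _ _ f' p' hp')) :=
  AWFS.IsAlgHom.compStr hj (AWFS.IsAlgHom.pulledStr _ _ _ (U.arrMap_vcomp i j).symm hp hp' hi)
    (wMap_right U (J.ar j) s) (wMap U (J.ar (J.vcomp i j)) s)
    ((wMap_left U (J.ar (J.vcomp i j)) s).trans (wMap_left U (J.ar j) s).symm)
    (wMap_right U (J.ar (J.vcomp i j)) s)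

variable [BraidedCategory V]

variable (𝓜 U) in
lemma isVNatural_srcPresheaf {f f' : Arrow C} (s : f ⟶ f') :
    IsVNatural V (srcPresheaf 𝓜 U f) (srcPresheaf 𝓜 U f') fun i => 𝓜.Kmap (wMap U i.unop s) :=
  ((isVNatural_diagContra s).functor_comp (opFunctor U.arrFunctor)).comp_functor 𝓜.K

variable (U) in
lemma isVNatural_tgtPresheaf {f f' : Arrow C} (s : f ⟶ f') :
    IsVNatural V (tgtPresheaf (V := V) U f) (tgtPresheaf U f') fun i => (wMap U i.unop s).left :=
  ((isVNatural_contraHom s.left).functor_comp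
    ((opFunctor U.arrFunctor).comp V (opFunctor (codFunctor V C)))).congr
      fun i => (wMap_left U i.unop s).symm

lemma IsPitchfork.of_jointlyAlgEpi {I : Type u₃}
    {X : I → Inserter (srcStr 𝓜 U) (tgtStr (V := V) U)} (hX : ∀ d, IsPitchfork 𝓜 U (X d))
    {x : Inserter (srcStr 𝓜 U) (tgtStr (V := V) U)} {s : ∀ d, X d ⟶ x}
    (hs : ∀ i, 𝓜.JointlyAlgEpi fun d => wMap U i (s d).hom) : IsPitchfork 𝓜 U x := by
  have isAlgHom (d : I) (i : J.Arr) : 𝓜.IsAlgHom (wMap U i (s d).hom) ((X d).str i) (x.str i) :=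
    isAlgHom_wMap_iff.2 ((s d).comm i)
  have alg (i : J.Arr) : 𝓜.IsAlg (wArr U i x.obj) (x.str i) :=
    .of_jointlyAlgEpi (hs i) (fun d => (hX d).alg i) fun d => isAlgHom d i
  refine ⟨alg, ?_, fun i j => (hs _).Kmap fun d => ?_⟩
  · exact .of_jointlyVEpi (fun d => (hX d).natural)
      (fun d => isVNatural_srcPresheaf 𝓜 U (s d).hom) (fun d => isVNatural_tgtPresheaf U (s d).hom)
      (fun d i => isAlgHom d i.unop) fun i => (hs i.unop).Kmap.jointlyVEpi
  · refine (isAlgHom d _).trans (Eq.trans (congrArg (· ≫ (wMap U _ (s d).hom).left)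
      ((hX d).comp i j)) (Eq.symm ?_))
    exact isAlgHom_compStr_pulledStr (s d).hom i j ((hX d).alg _) (alg _) (isAlgHom d _)
      (isAlgHom d _)

end Pitchfork

section ComponentwiseColimits

variable {C : Type u₂} [Category.{v₂} C] {𝒟 : Type u₃} [Category.{v₃} 𝒟]
variable {F : 𝒟 ⥤ Arrow C} {c : Cocone F}

/-- A cocone in a category of arrows is a componentwise colimit when its domain and codomain
parts are colimits. This implies that it is a colimit, and is stronger in the absence of colimits
in `C`. -/
structure IsComponentwiseColimit (c : Cocone F) : Prop where
  left : Nonempty (IsColimit (Arrow.leftFunc.mapCocone c))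
  right : Nonempty (IsColimit (Arrow.rightFunc.mapCocone c))

namespace IsComponentwiseColimit

lemma nonempty_isColimit (h : IsComponentwiseColimit c) : Nonempty (IsColimit c) :=
  ⟨Comma.fstSndJointlyReflectColimit h.left.some h.right.some⟩

section

variable {V : Type u₁} [Category.{v₁} V] [MonoidalCategory V] [HasPullbacks V]
  [EnrichedOrdinaryCategory V C]

lemma map_R (𝓕 : FunctorialFactorisation V C) [PreservesColimitsOfShape 𝒟 (underlying 𝓕.K)]
    (h : IsComponentwiseColimit c) :
    IsComponentwiseColimit ((underlying 𝓕.R).mapCocone c) := by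
  let leftIso : underlying 𝓕.K ≅ underlying 𝓕.R ⋙ Arrow.leftFunc :=
    NatIso.ofComponents (fun _ => Iso.refl _) fun s =>
      (Category.comp_id _).trans ((congrArg CommaMorphism.left (𝓕.mapHom_R s)).symm.trans
        (Category.id_comp _).symm)
  let rightIso : Arrow.rightFunc ≅ underlying 𝓕.R ⋙ Arrow.rightFunc :=
    NatIso.ofComponents (fun _ => Iso.refl _) fun s =>
      (Category.comp_id _).trans ((congrArg CommaMorphism.right (𝓕.mapHom_R s)).symm.trans
        (Category.id_comp _).symm)
  exact ⟨⟨.mapCoconeEquiv leftIso (isColimitOfPreserves _ h.nonempty_isColimit.some)⟩,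
    ⟨.mapCoconeEquiv rightIso h.right.some⟩⟩

lemma jointlyAlgEpi (𝓐 : AWFS V C) [PreservesColimitsOfShape 𝒟 (underlying 𝓐.K)]
    (h : IsComponentwiseColimit c) : 𝓐.JointlyAlgEpi c.ι.app where
  left := jointlyEpi_of_isColimit h.left.some
  Kmap := jointlyEpi_of_isColimit
    (isColimitOfPreserves (underlying 𝓐.K) h.nonempty_isColimit.some)
  Kmap_Rmap := by
    simp only [← 𝓐.mapHom_R]
    obtain ⟨hR⟩ := (h.map_R 𝓐.toFunctorialFactorisation).nonempty_isColimit
    exact jointlyEpi_of_isColimit (isColimitOfPreserves (underlying 𝓐.K) hR)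

end

lemma map_diagCov {V : Type u₁} [Category.{v₁} V] [MonoidalCategory V] [MonoidalClosed V]
    [HasPullbacks V] [EnrichedOrdinaryCategory V C] (g : Arrow C)
    (hl : Nonempty (IsColimit
      ((Arrow.leftFunc ⋙ (eHomFunctor V C).obj (op g.right)).mapCocone c)))
    (hr : Nonempty (IsColimit (((eHomFunctor V (Arrow C)).obj (op g)).mapCocone c))) :
    IsComponentwiseColimit ((underlying (diagCov V g)).mapCocone c) := by
  let leftIso : Arrow.leftFunc ⋙ (eHomFunctor V C).obj (op g.right) ≅
      underlying (diagCov V g) ⋙ Arrow.leftFunc :=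
    NatIso.ofComponents (fun _ => Iso.refl _) fun s =>
      (Category.comp_id _).trans ((mapHom_diagCov_left (V := V) g s).symm.trans
        (Category.id_comp _).symm)
  let rightIso : (eHomFunctor V (Arrow C)).obj (op g) ≅
      underlying (diagCov V g) ⋙ Arrow.rightFunc :=
    NatIso.ofComponents (fun _ => Iso.refl _) fun s =>
      (Category.comp_id _).trans ((mapHom_diagCov_right (V := V) g s).symm.trans
        (Category.id_comp _).symm)
  exact ⟨⟨.mapCoconeEquiv leftIso hl.some⟩, ⟨.mapCoconeEquiv rightIso hr.some⟩⟩

end IsComponentwiseColimit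

end ComponentwiseColimits

section Creation

variable {V : Type u₁} [Category.{v₁} V] [MonoidalCategory V] [MonoidalClosed V] [HasPullbacks V]
variable [BraidedCategory V] {C : Type u₂} [Category.{v₂} C] [EnrichedOrdinaryCategory V C]
variable {J : InternalCat.{v₁, u₁, w} V} {𝓜 : AWFS V V} {U : J.ToSq C}
variable {𝒟 : Type w'} [SmallCategory 𝒟] [PreservesColimitsOfShape 𝒟 (underlying 𝓜.K)]
  {D : 𝒟 ⥤ Pitchfork 𝓜 U}

lemma exists_isAlgHom_wMap {c : Cocone (D ⋙ pitchforkForget 𝓜 U)} {i : J.Arr}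
    (hc : Nonempty (IsColimit ((underlying (diagCov V (U.arrFunctor.obj i))).mapCocone c))) :
    ∃ p : 𝓜.K.obj (wArr U i c.pt) ⟶ (wArr U i c.pt).left,
      ∀ d, 𝓜.IsAlgHom (wMap U i (c.ι.app d)) ((D.obj d).obj.str i) p := by
  have wMap_comp {d d' : 𝒟} (φ : d ⟶ d') :
      wMap U i (D.map φ).hom.hom ≫ wMap U i (c.ι.app d') = wMap U i (c.ι.app d) :=
    (mapHom_comp (diagCov V (U.arrFunctor.obj i)) _ _).symm.trans (congrArg _ (c.w φ))
  have isAlgHom {d d' : 𝒟} (φ : d ⟶ d') : 𝓜.IsAlgHom (wMap U i (D.map φ).hom.hom)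
      ((D.obj d).obj.str i) ((D.obj d').obj.str i) :=
    isAlgHom_wMap_iff.2 ((D.map φ).hom.comm i)
  let t : Cocone ((D ⋙ pitchforkForget 𝓜 U) ⋙
      underlying (diagCov V (U.arrFunctor.obj i)) ⋙ underlying 𝓜.K) :=
    { pt := (wArr U i c.pt).left
      ι := { app d := (D.obj d).obj.str i ≫ (wMap U i (c.ι.app d)).left
             naturality d d' φ := by
               refine (Category.assoc _ _ _).symm.trans ((congrArg (· ≫ _) (isAlgHom φ)).trans ?_)
               refine (Category.assoc _ _ _).trans (Eq.trans ?_ (Category.comp_id _).symm)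
               exact congrArg _ (congrArg CommaMorphism.left (wMap_comp φ)) } }
  have hK := isColimitOfPreserves (underlying 𝓜.K) hc.some
  exact ⟨hK.desc t, hK.fac t⟩

lemma existsUnique_mapCocone_pitchforkForget_eq {c : Cocone (D ⋙ pitchforkForget 𝓜 U)}
    (h : ∀ i, IsComponentwiseColimit
      ((underlying (diagCov V (U.arrFunctor.obj i))).mapCocone c)) :
    ∃! c' : Cocone D, (pitchforkForget 𝓜 U).mapCocone c' = c := by
  have epi (i : J.Arr) : 𝓜.JointlyAlgEpi fun d => wMap U i (c.ι.app d) := (h i).jointlyAlgEpi 𝓜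
  choose p hp using fun i => exists_isAlgHom_wMap (h i).nonempty_isColimit
  let x : Inserter (srcStr 𝓜 U) (tgtStr (V := V) U) := ⟨c.pt, p⟩
  let s (d : 𝒟) : (D.obj d).obj ⟶ x := ⟨c.ι.app d, fun i => (isAlgHom_wMap_iff (y := x)).1 (hp i d)⟩
  have hx : IsPitchfork 𝓜 U x := .of_jointlyAlgEpi (fun d => (D.obj d).property) (s := s) epi
  let c₁ : Cocone D :=
    { pt := ⟨x, hx⟩
      ι := { app d := ObjectProperty.homMk (s d)
             naturality _ _ φ := ObjectProperty.hom_ext _ (Inserter.Hom.ext (c.ι.naturality φ)) } }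
  refine ⟨c₁, rfl, fun c' hc' => ?_⟩
  subst hc'
  obtain rfl : c'.pt.obj.str = p := funext fun i => (epi i).Kmap fun d =>
    (isAlgHom_wMap_iff.2 ((c'.ι.app d).hom.comm i)).trans (hp i d).symm
  rfl

lemma jointlyVEpi_srcStr {F : 𝒟 ⥤ Arrow C} {c : Cocone F} {i : J.Arr}
    (hc : Nonempty (IsColimit ((underlying (diagCov V (U.arrFunctor.obj i))).mapCocone c))) :
    JointlyVEpi V ((underlying (srcStr 𝓜 U i)).mapCocone c).ι.app := by
  let e : underlying (diagCov V (U.arrFunctor.obj i)) ⋙ underlying 𝓜.K ≅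
      underlying (srcStr 𝓜 U i) :=
    NatIso.ofComponents (fun _ => Iso.refl _) fun s =>
      (Category.comp_id _).trans ((mapHom_srcStr 𝓜 U i s).symm.trans (Category.id_comp _).symm)
  exact (jointlyEpi_of_isColimit
    (.mapCoconeEquiv e (isColimitOfPreserves (underlying 𝓜.K) hc.some))).jointlyVEpi

lemma isConicalColimit_of_pitchforkForget [HasEqualizers V] [HasProductsOfShape J.Arr V]
    {c : Cocone D} (hc : IsConicalColimit V ((pitchforkForget 𝓜 U).mapCocone c))
    (h : ∀ i, IsComponentwiseColimit
      ((underlying (diagCov V (U.arrFunctor.obj i))).mapCocone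
        ((pitchforkForget 𝓜 U).mapCocone c))) :
    IsConicalColimit V c :=
  .fullSubcategory (Inserter.isConicalColimit_of_forget hc fun i =>
    jointlyVEpi_srcStr (h i).nonempty_isColimit)

theorem createsConicalColimit_pitchforkForget [HasEqualizers V] [HasProductsOfShape J.Arr V]
    (hD : ∀ c : Cocone (D ⋙ pitchforkForget 𝓜 U), IsColimit c → IsConicalColimit V c ∧
      ∀ i, IsComponentwiseColimit
        ((underlying (diagCov V (U.arrFunctor.obj i))).mapCocone c)) :
    CreatesConicalColimit V (pitchforkForget 𝓜 U) D := by
  intro c hc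
  obtain ⟨conical, componentwise⟩ := hD c hc.some
  refine ⟨existsUnique_mapCocone_pitchforkForget_eq componentwise, fun c' hc' => ?_⟩
  subst hc'
  exact isConicalColimit_of_pitchforkForget conical componentwise

end Creation

section Nerve

/-- The category `0 ⟶ 1 ⟶ ⋯ ⟶ n`. -/
abbrev ordCat (n : ℕ) : Cat.{u, u} := Cat.of (ULift.{u} (Fin (n + 1)))

/-- Functors out of `0 ⟶ 1 ⟶ ⋯ ⟶ n` are chains of `n` composable arrows. -/
def ordCatHomEquiv (n : ℕ) (X : Cat.{u, u}) : (ordCat.{u} n ⟶ X) ≃ ComposableArrows X n where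
  toFun F := Monotone.functor (f := ULift.up) (fun _ _ h => h) ⋙ F.toFunctor
  invFun F := (Monotone.functor (f := ULift.down) (fun _ _ h => h) ⋙ F).toCatHom
  left_inv _ := rfl
  right_inv _ := rfl

/-- The components of the `2`-truncated nerve are represented by `0 ⟶ ⋯ ⟶ n`, for `n ≤ 2`. -/
def coyonedaOrdCatIso (n : ℕ) (hn : n ≤ 2) : coyoneda.obj (op (ordCat.{u} n)) ≅
    Nerve.nerveFunctor₂.{u, u} ⋙ (evaluation _ _).obj (op ⟨SimplexCategory.mk n, hn⟩) :=
  NatIso.ofComponents (fun X => (ordCatHomEquiv n X).toIso) fun _ => rfl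

lemma nonempty_isColimit_of_ordCat {𝒟 : Type u₁} [Category.{v₁} 𝒟] {F : 𝒟 ⥤ Cat.{u, u}}
    (c : Cocone F)
    (h : ∀ n ≤ 2, Nonempty (IsColimit ((coyoneda.obj (op (ordCat.{u} n))).mapCocone c))) :
    Nonempty (IsColimit c) := by
  refine ⟨isColimitOfReflects Nerve.nerveFunctor₂.{u, u}
    (evaluationJointlyReflectsColimits _ fun k => ?_)⟩
  obtain ⟨⟨k, hk⟩⟩ := k
  induction k with | _ n
  exact .mapCoconeEquiv (coyonedaOrdCatIso n hk) (h n hk).some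

end Nerve

section Base

/-- A functor from a preorder `β` with a one-sided inverse on objects exhibits `β` as a retract of
its codomain. -/
def retractOfLeftInverse {β : Type u} [PartialOrder β] {Y : Cat.{u, u}} {i : β ⥤ Y} {r : Y ⥤ β}
    (h : Function.LeftInverse r.obj i.obj) : Retract (Cat.of β) Y where
  i := i.toCatHom
  r := r.toCatHom
  retract := by
    ext1
    exact CategoryTheory.Functor.ext (C := β) (D := β) h fun _ _ _ => Subsingleton.elim _ _

namespace IsBase

variable (P : ObjectProperty Cat.{u, u}) [IsBase P]

lemma prop_of_retract {X Y : Cat.{u, u}} (r : Retract X Y) (hY : P Y) : P X := by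
  have := IsBase.closedUnderLimits (P := P) (ULiftHom.{u} (ULift.{u} WalkingParallelPair))
  have : P.IsClosedUnderLimitsOfShape WalkingParallelPair :=
    .of_equivalence (ULiftHomULiftCategory.equiv.{u, u} WalkingParallelPair).symm
  refine P.prop_of_isLimit (isSplitMonoEqualizes r.i) ?_
  rintro (_ | _) <;> exact hY

lemma prop_ordCat_zero : P (ordCat.{u} 0) :=
  prop_of_retract P (Y := ordCat.{u} 1)
    (retractOfLeftInverse (β := ULift.{u} (Fin 1)) (i := (Functor.const _).obj (ULift.up 0))
      (r := (Functor.const _).obj (ULift.up 0)) fun _ => ULift.ext _ _ (Subsingleton.elim _ _))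
    prop_two

/-- The ordinal `3` is the retract of `2 × 2` given by the chain `(0, 0) ≤ (0, 1) ≤ (1, 1)`, with
retraction `(a, b) ↦ a + b`. -/
lemma prop_ordCat_two : P (ordCat.{u} 2) := by
  have prop_prod : P (Cat.of (ULift.{u} (Fin 2) × ULift.{u} (Fin 2))) :=
    ObjectProperty.prop_tensor (prop_two (P := P)) (prop_two (P := P))
  have mono₁ : Monotone fun x : ULift.{u} (Fin 3) => ULift.up.{u} (if x.down = 2 then 1 else 0 :
      Fin 2) := by
    have : Monotone fun x : Fin 3 => (if x = 2 then 1 else 0 : Fin 2) := by decide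
    exact fun _ _ h => this h
  have mono₂ : Monotone fun x : ULift.{u} (Fin 3) => ULift.up.{u} (if x.down = 0 then 0 else 1 :
      Fin 2) := by
    have : Monotone fun x : Fin 3 => (if x = 0 then 0 else 1 : Fin 2) := by decide
    exact fun _ _ h => this h
  let sum : ULift.{u} (Fin 2) × ULift.{u} (Fin 2) ⥤ ULift.{u} (Fin 3) :=
    { obj x := ⟨⟨x.1.down + x.2.down, by omega⟩⟩
      map {x y} f := homOfLE (by
        have h₁ : x.1 ≤ y.1 := leOfHom f.1
        have h₂ : x.2 ≤ y.2 := leOfHom f.2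
        exact Nat.add_le_add h₁ h₂) }
  refine prop_of_retract P (retractOfLeftInverse (β := ULift.{u} (Fin 3))
    (i := mono₁.functor.prod' mono₂.functor) (r := sum) fun x => ?_) prop_prod
  have add_eq : ∀ a : Fin 3, (if a = 2 then 1 else 0 : Fin 2).val +
      (if a = 0 then 0 else 1 : Fin 2).val = a := by decide
  exact ULift.ext _ _ (Fin.ext (add_eq _))

lemma prop_ordCat : ∀ n ≤ 2, P (ordCat.{u} n)
  | 0, _ => prop_ordCat_zero P
  | 1, _ => prop_two
  | 2, _ => prop_ordCat_two P

end IsBase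

variable (P : ObjectProperty Cat.{u, u}) [IsBase P]

/-- The category `0 ⟶ ⋯ ⟶ n` as an object of a base of enrichment, for `n ≤ 2`. -/
abbrev ordBase (n : Fin 3) : P.FullSubcategory :=
  ⟨ordCat.{u} n, IsBase.prop_ordCat P n (Nat.le_of_lt_succ n.2)⟩

lemma jointlyReflectFilteredColimits_ordBase (κ : Cardinal.{u}) [Fact κ.IsRegular] :
    JointlyReflectFilteredColimits (ordBase P) κ := fun 𝒟 _ _ X c h => by
  obtain ⟨hc⟩ := nonempty_isColimit_of_ordCat (P.ι.mapCocone c) fun n hn => by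
    let e : coyoneda.obj (op (ordBase P ⟨n, Nat.lt_succ_of_le hn⟩)) ≅
        P.ι ⋙ coyoneda.obj (op (ordCat.{u} n)) :=
      NatIso.ofComponents (fun X => P.fullyFaithfulι.homEquiv.toIso) fun _ => rfl
    exact ⟨.mapCoconeEquiv e (h ⟨n, Nat.lt_succ_of_le hn⟩).some⟩
  exact ⟨isColimitOfReflects P.ι hc⟩

end Base

section Cocomplete

variable {V : Type u₁} [Category.{v₁} V] [MonoidalCategory V] [MonoidalClosed V]
variable {C : Type u₂} [Category.{v₂} C] [EnrichedOrdinaryCategory V C]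

namespace IsCocomplete

lemma hasColimitsOfSize (hC : IsCocomplete.{v₁, u₁, v₂, u₂, w} V C) :
    HasColimitsOfSize.{w, w} C where
  has_colimits_of_shape 𝒟 :=
    { has_colimit F := by
        obtain ⟨c, hc⟩ := hC.exists_conicalColimit F
        exact ⟨c, hc.nonempty_isColimit.some⟩ }

lemma isConicalColimit_arrow [HasPullbacks V] (hC : IsCocomplete.{v₁, u₁, v₂, u₂, w} V C)
    {𝒟 : Type w} [SmallCategory 𝒟] {F : 𝒟 ⥤ Arrow C} {c : Cocone F} (hc : IsColimit c) :
    IsConicalColimit V c := by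
  have := hC.hasColimitsOfSize
  obtain ⟨cl, hcl⟩ := hC.exists_conicalColimit (F ⋙ Arrow.leftFunc)
  obtain ⟨cr, hcr⟩ := hC.exists_conicalColimit (F ⋙ Arrow.rightFunc)
  exact .arrow (hcl.of_isColimit (isColimitOfPreserves _ hc))
    (hcr.of_isColimit (isColimitOfPreserves _ hc))

end IsCocomplete

lemma JointlyReflectFilteredColimits.isComponentwiseColimit_map_diagCov [HasPullbacks V]
    [HasColimitsOfSize.{w, w} C] {κ : Cardinal.{w}} [Fact κ.IsRegular] {I : Type u₃} {G : I → V}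
    (hG : JointlyReflectFilteredColimits G κ) {M : MorphismProperty C} {g : Arrow C}
    (hl : ∀ n, FunctorHasRankLE M
      ((eHomFunctor V C).obj (op g.left) ⋙ coyoneda.obj (op (G n))) κ)
    (hr : ∀ n, FunctorHasRankLE M
      ((eHomFunctor V C).obj (op g.right) ⋙ coyoneda.obj (op (G n))) κ)
    {𝒟 : Type w} [SmallCategory 𝒟] [IsCardinalFiltered 𝒟 κ] {F : 𝒟 ⥤ Arrow C} {m c : Cocone F}
    (hm : ∀ d, componentwise M (m.ι.app d)) (hc : IsColimit c) :
    IsComponentwiseColimit ((underlying (diagCov V g)).mapCocone c) := by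
  have : PreservesColimitsOfSize.{w, w} (Arrow.leftFunc : Arrow C ⥤ C) := ⟨inferInstance⟩
  have rank_left : FunctorHasRankLE (componentwise M)
      (Arrow.leftFunc ⋙ (eHomFunctor V C).obj (op g.right)) κ :=
    (hG.functorHasRankLE hr).comp_left Arrow.leftFunc fun _ _ _ h => h.1
  have rank_right : FunctorHasRankLE (componentwise M)
      ((eHomFunctor V (Arrow C)).obj (op g)) κ :=
    hG.functorHasRankLE fun n => .eHomFunctor_arrow g (G n) (hl n) (hr n)
  have := rank_left 𝒟 F m hm
  have := rank_right 𝒟 F m hm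
  exact .map_diagCov g ⟨isColimitOfPreserves _ hc⟩ ⟨isColimitOfPreserves _ hc⟩

end Cocomplete

end EnrichedAWFS

theorem mainTheorem7_general {V : Type u₁} [Category.{v₁} V] [MonoidalCategory V]
    [MonoidalClosed V] [BraidedCategory V] [HasPullbacks V] [HasEqualizers V] [HasProducts.{w} V]
    {I : Type u₃} [Small.{w} I] {G : I → V} {κ₀ : Cardinal.{w}} [Fact κ₀.IsRegular]
    (hG : JointlyReflectFilteredColimits G κ₀)
    (𝓜 : AWFS V V) [(underlying 𝓜.K).IsAccessible.{w}]
    {C : Type u₂} [Category.{v₁} C] [EnrichedOrdinaryCategory V C]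
    (hC : IsCocomplete.{v₁, u₁, v₁, u₂, w} V C) (M : MorphismProperty C)
    (hM : ∀ A : C, ∃ (κ : Cardinal.{w}) (_ : Fact κ.IsRegular), HasRankLE M A κ)
    (J : InternalCat.{v₁, u₁, w} V) (U : J.ToSq C) :
    ∃ (κ : Cardinal.{w}) (_ : Fact κ.IsRegular),
      ∀ (𝒟 : Type w) [SmallCategory 𝒟] [IsCardinalFiltered 𝒟 κ]
        (D : 𝒟 ⥤ Pitchfork 𝓜 U) (m : Cocone (D ⋙ pitchforkForget 𝓜 U)),
        (∀ d, M (m.ι.app d).left ∧ M (m.ι.app d).right) →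
          CreatesConicalColimit V (pitchforkForget 𝓜 U) D := by
  obtain ⟨κK, _, hK⟩ := Functor.IsAccessible.exists_cardinal (F := underlying 𝓜.K)
  obtain ⟨κl, _, hl⟩ := exists_functorHasRankLE_eHomFunctor hM hC.exists_tensor
    (fun i : J.Arr => (U.arrFunctor.obj i).left) G
  obtain ⟨κr, _, hr⟩ := exists_functorHasRankLE_eHomFunctor hM hC.exists_tensor
    (fun i : J.Arr => (U.arrFunctor.obj i).right) G
  obtain ⟨κ, _, hκ⟩ := exists_isRegular_forall_le ![κ₀, κK, κl, κr]
  refine ⟨κ, ‹_›, fun 𝒟 _ _ D m hm => ?_⟩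
  have := Functor.isCardinalAccessible_of_le (κ := κK) (underlying 𝓜.K) (hκ 1)
  have := (underlying 𝓜.K).preservesColimitsOfShape_of_isCardinalAccessible κ 𝒟
  have := hC.hasColimitsOfSize
  exact createsConicalColimit_pitchforkForget fun c hc => ⟨hC.isConicalColimit_arrow hc, fun i =>
    (hG.of_le (hκ 0)).isComponentwiseColimit_map_diagCov (fun n => (hl i n).of_le (hκ 2))
      (fun n => (hr i n).of_le (hκ 3)) hm hc⟩

theorem mainTheorem7 (P : ObjectProperty Cat.{u, u}) [IsBase P]
    (𝓜 : AWFS P.FullSubcategory P.FullSubcategory)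
    (h𝓜 : AWFS.Cocontinuous.{u, u + 1, u, u + 1, u} 𝓜)
    {C : Type w} [Category.{u} C] [EnrichedOrdinaryCategory P.FullSubcategory C]
    (hC : IsCocomplete.{u, u + 1, u, w, u} P.FullSubcategory C)
    (E M : MorphismProperty C) (hEM : IsLocallyRanked.{u, w, u} E M)
    (J : InternalCat.{u, u + 1, u} P.FullSubcategory) (U : J.ToSq C) :
    ∃ (κ : Cardinal.{u}) (_ : Fact κ.IsRegular),
      ∀ (𝒟 : Type u) [SmallCategory 𝒟] [IsCardinalFiltered 𝒟 κ]
        (D : 𝒟 ⥤ Pitchfork 𝓜 U) (m : Cocone (D ⋙ pitchforkForget 𝓜 U)),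
        (∀ d, M (m.ι.app d).left ∧ M (m.ι.app d).right) →
          CreatesConicalColimit P.FullSubcategory (pitchforkForget 𝓜 U) D := by
  have : PreservesColimitsOfSize.{u, u} (underlying 𝓜.K) := h𝓜
  have := Cardinal.fact_isRegular_aleph0.{u}
  have := Functor.isAccessible_of_isCardinalAccessible (underlying 𝓜.K) Cardinal.aleph0.{u}
  exact mainTheorem7_general (jointlyReflectFilteredColimits_ordBase P Cardinal.aleph0) 𝓜 hC M
    hEM.exists_rank J U
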